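/- Let $k$ be a field and let $A$ be a finite-dimensional elementary $k$-algebra (that is, $A/\operatorname{rad}A$ is isomorphic as a $k$-algebra to a finite product of copies of $k$) of finite global dimension. Let $e_1,\dots,e_r$ be a complete set of orthogonal primitive idempotents of $A$, let $A^e=A\otimes_k A^{\mathrm{op}}$ be the enveloping algebra, and let $M$ be a perfect complex of $A$-bimodules, that is, one quasi-isomorphic to a bounded complex of finitely generated projective $A^e$-modules. For a finite-dimensional $A$-bimodule $X$ put $C_X=(\dim_k e_jXe_i)_{1\le i,j\le r}$; in particular $C_A=(\dim_k e_jAe_i)_{i,j}$ is the Cartan matrix of $A$. Put $C_M=\sum_{l\in\mathbb Z}(-1)^l C_{H^l(M)}$. Then $C_A$ is invertible over $\mathbb Z$, and for the dual Coxeter matrix $\Psi_M:=-C_MC_A^{-1}$ the Hochschild homology entropy $$h^{HH_\bullet}(M):=\limsup_{n\to\infty}\frac1n\log\sum_{i\in\mathbb Z}\dim_k H^i\bigl(A\otimes^{L}_{A^e}M^{\otimes^{L}_A n}\bigr)$$ satisfies the Yomdin-type inequality $$h^{HH_\bullet}(M)\ \ge\ \log\rho(\Psi_M).$$ Here $\rho$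 is the spectral radius, i.e. the largest absolute value of a complex eigenvalue, with $\rho=0$ for the empty matrix, and $\log 0=-\infty$. -/

import Mathlib

open CategoryTheory
open scoped TensorProduct

universe u

noncomputable section

namespace HHEntropy

/-! ### Bimodules as modules over the enveloping algebra -/

/-- The enveloping algebra, written so that `A`-bimodules are left modules over it:
`(a ⊗ a'ᵒᵖ) • x = a x a'`. -/
abbrev Env (k A : Type u) [Field k] [Ring A] [Algebra k A] : Type u := A ⊗[k] Aᵐᵒᵖ

section Unbundled

variable (k A : Type u) [Field k] [Ring A] [Algebra k A]
variable (M N : Type u) [AddCommGroup M] [Module k M] [Module (Env k A) M]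
  [IsScalarTower k (Env k A) M]
  [AddCommGroup N] [Module k N] [Module (Env k A) N] [IsScalarTower k (Env k A) N]
variable {M' N' : Type u} [AddCommGroup M'] [Module k M'] [Module (Env k A) M']
  [IsScalarTower k (Env k A) M']
  [AddCommGroup N'] [Module k N'] [Module (Env k A) N'] [IsScalarTower k (Env k A) N']

/-- The outer action of `Aᵉ` on `M ⊗ₖ N`: `(a ⊗ a'ᵒᵖ) • (m ⊗ n) = a m ⊗ n a'`. -/
def outerAction : Env k A →ₐ[k] Module.End k (M ⊗[k] N) :=
  Algebra.TensorProduct.lift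
    (((Module.End.rTensorAlgHom k M N).comp (Algebra.lsmul k k M)).comp
      (Algebra.TensorProduct.includeLeft : A →ₐ[k] Env k A))
    (((Module.End.lTensorAlgHom k N M).comp (Algebra.lsmul k k N)).comp
      (Algebra.TensorProduct.includeRight : Aᵐᵒᵖ →ₐ[k] Env k A))
    (fun a b => by
      change LinearMap.rTensor N (Algebra.lsmul k k M (a ⊗ₜ[k] (1 : Aᵐᵒᵖ) : Env k A)) ∘ₗ
          LinearMap.lTensor M (Algebra.lsmul k k N ((1 : A) ⊗ₜ[k] b : Env k A)) =
        LinearMap.lTensor M (Algebra.lsmul k k N ((1 : A) ⊗ₜ[k] b : Env k A)) ∘ₗ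
          LinearMap.rTensor N (Algebra.lsmul k k M (a ⊗ₜ[k] (1 : Aᵐᵒᵖ) : Env k A))
      rw [LinearMap.rTensor_comp_lTensor, LinearMap.lTensor_comp_rTensor])

theorem outerAction_tmul (a : A) (b : Aᵐᵒᵖ) (m : M) (n : N) :
    outerAction k A M N (a ⊗ₜ[k] b) (m ⊗ₜ[k] n)
      = ((a ⊗ₜ[k] (1 : Aᵐᵒᵖ) : Env k A) • m) ⊗ₜ[k] (((1 : A) ⊗ₜ[k] b : Env k A) • n) := by
  rw [outerAction, Algebra.TensorProduct.lift_tmul]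
  rfl

/-- `M ⊗ₖ N`, regarded as an `A`-bimodule through the outer action. -/
def OuterTensor (k A : Type u) [Field k] [Ring A] [Algebra k A] (M N : Type u)
    [AddCommGroup M] [Module k M] [Module (Env k A) M] [IsScalarTower k (Env k A) M]
    [AddCommGroup N] [Module k N] [Module (Env k A) N] [IsScalarTower k (Env k A) N] : Type u :=
  M ⊗[k] N

instance : AddCommGroup (OuterTensor k A M N) :=
  inferInstanceAs (AddCommGroup (M ⊗[k] N))

instance : Module (Env k A) (OuterTensor k A M N) :=
  Module.compHom (M ⊗[k] N) (outerAction k A M N).toRingHom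

/-- A pure tensor `m ⊗ n`, as an element of the bimodule `M ⊗ₖ N`. -/
def outerMk (m : M) (n : N) : OuterTensor k A M N := m ⊗ₜ[k] n

/-- The sub-bimodule of `M ⊗ₖ N` generated by all `m a ⊗ n - m ⊗ a n`. -/
def balancing : Submodule (Env k A) (OuterTensor k A M N) :=
  Submodule.span (Env k A)
    {z | ∃ (m : M) (a : A) (n : N), z =
      outerMk k A M N (((1 : A) ⊗ₜ[k] MulOpposite.op a : Env k A) • m) n
        - outerMk k A M N m ((a ⊗ₜ[k] (1 : Aᵐᵒᵖ) : Env k A) • n)}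

/-- The tensor product `M ⊗_A N` of two `A`-bimodules, again an `A`-bimodule. -/
abbrev BimodTensor : Type u := OuterTensor k A M N ⧸ balancing k A M N

variable {M N}

/-- `f ⊗ₖ g`, for bimodule maps `f` and `g`. -/
def outerMap (f : M →ₗ[Env k A] M') (g : N →ₗ[Env k A] N') :
    OuterTensor k A M N →ₗ[Env k A] OuterTensor k A M' N' where
  toFun := TensorProduct.map (f.restrictScalars k) (g.restrictScalars k)
  map_add' := map_add _
  map_smul' r z := by
    change TensorProduct.map (f.restrictScalars k) (g.restrictScalars k)
        (outerAction k A M N r z) = outerAction k A M' N' r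
        (TensorProduct.map (f.restrictScalars k) (g.restrictScalars k) z)
    refine LinearMap.congr_fun (f := (TensorProduct.map (f.restrictScalars k)
      (g.restrictScalars k)) ∘ₗ (outerAction k A M N r)) (g := (outerAction k A M' N' r) ∘ₗ
      (TensorProduct.map (f.restrictScalars k) (g.restrictScalars k))) ?_ z
    induction r using TensorProduct.induction_on with
    | zero => simp
    | add x y hx hy =>
      rw [map_add, map_add, LinearMap.comp_add, LinearMap.add_comp, hx, hy]
    | tmul a b =>
      apply TensorProduct.ext'
      intro m n
      simp [outerAction_tmul]

@[simp] theorem outerMap_outerMk (f : M →ₗ[Env k A] M') (g : N →ₗ[Env k A] N') (m : M) (n : N) :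
    outerMap k A f g (outerMk k A M N m n) = outerMk k A M' N' (f m) (g n) := rfl

/-- `f ⊗_A g`, for bimodule maps `f` and `g`. -/
def tensorMap (f : M →ₗ[Env k A] M') (g : N →ₗ[Env k A] N') :
    BimodTensor k A M N →ₗ[Env k A] BimodTensor k A M' N' :=
  Submodule.mapQ _ _ (outerMap k A f g) (by
    refine Submodule.span_le.2 ?_
    rintro _ ⟨m, a, n, rfl⟩
    refine Submodule.subset_span ⟨f m, a, g n, ?_⟩
    simp [map_sub])

/-- The class of `m ⊗ n` in `M ⊗_A N`. -/
def tensorMk (m : M) (n : N) : BimodTensor k A M N :=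
  Submodule.Quotient.mk (outerMk k A M N m n)

@[simp] theorem tensorMap_tensorMk (f : M →ₗ[Env k A] M') (g : N →ₗ[Env k A] N') (m : M) (n : N) :
    tensorMap k A f g (tensorMk k A m n) = tensorMk k A (f m) (g n) := rfl

theorem tensorMk_add_left (m m' : M) (n : N) :
    tensorMk k A (m + m') n = tensorMk k A m n + tensorMk k A m' n :=
  congrArg Submodule.Quotient.mk (TensorProduct.add_tmul m m' n)

theorem tensorMk_add_right (m : M) (n n' : N) :
    tensorMk k A m (n + n') = tensorMk k A m n + tensorMk k A m n' :=
  congrArg Submodule.Quotient.mk (TensorProduct.tmul_add m n n')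

/-- Two bimodule maps out of `M ⊗_A N` agree if they agree on all `m ⊗ n`. -/
theorem tensor_hom_ext {P : Type u} [AddCommGroup P] [Module (Env k A) P]
    {φ ψ : BimodTensor k A M N →ₗ[Env k A] P}
    (h : ∀ m n, φ (tensorMk k A m n) = ψ (tensorMk k A m n)) : φ = ψ := by
  apply LinearMap.ext
  intro z
  obtain ⟨z, rfl⟩ := Submodule.Quotient.mk_surjective _ z
  revert z
  intro (z : M ⊗[k] N)
  induction z using TensorProduct.induction_on with
  | zero => exact (map_zero φ).trans (map_zero ψ).symm
  | tmul m n => exact h m n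
  | add x y hx hy =>
    exact (map_add φ _ _).trans ((congrArg₂ (· + ·) hx hy).trans (map_add ψ _ _).symm)

/-! ### The functor `A ⊗_{Aᵉ} -` -/

variable (M)

/-- The `k`-subspace of `A ⊗ₖ M` spanned by all `b·r ⊗ x - b ⊗ r·x` with
`r = a ⊗ a'ᵒᵖ ∈ Aᵉ`, where `Aᵉ` acts on `A` from the right by `b·(a ⊗ a'ᵒᵖ) = a' b a`. -/
def envBalancing : Submodule k (A ⊗[k] M) :=
  Submodule.span k
    {z | ∃ (b a a' : A) (x : M), z =
      (a' * b * a) ⊗ₜ[k] x - b ⊗ₜ[k] ((a ⊗ₜ[k] MulOpposite.op a' : Env k A) • x)}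

/-- The vector space `A ⊗_{Aᵉ} M`, for an `A`-bimodule `M`. -/
abbrev EnvTensor : Type u := (A ⊗[k] M) ⧸ envBalancing k A M

variable {M}

/-- `A ⊗_{Aᵉ} f`, for a bimodule map `f`. -/
def envTensorMap (f : M →ₗ[Env k A] M') : EnvTensor k A M →ₗ[k] EnvTensor k A M' :=
  Submodule.mapQ _ _ (TensorProduct.map LinearMap.id (f.restrictScalars k)) (by
    refine Submodule.span_le.2 ?_
    rintro _ ⟨b, a, a', x, rfl⟩
    refine Submodule.subset_span ⟨b, a, a', f x, ?_⟩
    simp [map_sub])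

theorem envTensor_hom_ext {P : Type u} [AddCommGroup P] [Module k P]
    {φ ψ : EnvTensor k A M →ₗ[k] P}
    (h : ∀ (b : A) (x : M), φ (Submodule.Quotient.mk (b ⊗ₜ[k] x))
      = ψ (Submodule.Quotient.mk (b ⊗ₜ[k] x))) : φ = ψ := by
  apply Submodule.linearMap_qext
  exact TensorProduct.ext' h

@[simp] theorem envTensorMap_mk (f : M →ₗ[Env k A] M') (b : A) (x : M) :
    envTensorMap k A f (Submodule.Quotient.mk (b ⊗ₜ[k] x))
      = Submodule.Quotient.mk (b ⊗ₜ[k] f x) := rfl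

end Unbundled

/-! ### Functors on categories of bimodules, and complexes -/

section Bundled

open scoped ModuleCat

variable (k A : Type u) [Field k] [Ring A] [Algebra k A]

/-- The category of `A`-bimodules (on which `k` acts centrally). -/
abbrev Bimod : Type (u + 1) := ModuleCat.{u} (Env k A)

/-- The bifunctor `(M, N) ↦ M ⊗_A N` on `A`-bimodules. -/
def tensorBifunctor : Bimod k A ⥤ Bimod k A ⥤ Bimod k A where
  obj M :=
    { obj := fun N => ModuleCat.of (Env k A) (BimodTensor k A M N)
      map := fun g => ModuleCat.ofHom (tensorMap k A LinearMap.id g.hom)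
      map_id := fun N => by
        ext1
        exact tensor_hom_ext k A fun m n => rfl
      map_comp := fun f g => by
        ext1
        exact tensor_hom_ext k A fun m n => rfl }
  map f :=
    { app := fun N => ModuleCat.ofHom (tensorMap k A f.hom LinearMap.id)
      naturality := fun N N' g => by
        ext1
        exact tensor_hom_ext k A fun m n => rfl }
  map_id M := by
    ext N : 2
    ext1
    exact tensor_hom_ext k A fun m n => rfl
  map_comp f g := by
    ext N : 2
    ext1
    exact tensor_hom_ext k A fun m n => rfl

instance : (tensorBifunctor k A).Additive where
  map_add {M M' f g} := by
    ext N : 2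
    ext1
    exact tensor_hom_ext k A fun m n => tensorMk_add_left k A (f.hom m) (g.hom m) n

instance (M : Bimod k A) : ((tensorBifunctor k A).obj M).Additive where
  map_add {N N' f g} := by
    ext1
    exact tensor_hom_ext k A fun m n => tensorMk_add_right k A m (f.hom n) (g.hom n)

/-- The functor `A ⊗_{Aᵉ} -` from `A`-bimodules to vector spaces. -/
def envTensorFunctor : Bimod k A ⥤ ModuleCat.{u} k where
  obj M := ModuleCat.of k (EnvTensor k A M)
  map f := ModuleCat.ofHom (envTensorMap k A f.hom)
  map_id M := by
    ext1
    exact envTensor_hom_ext k A fun b x => rfl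
  map_comp f g := by
    ext1
    exact envTensor_hom_ext k A fun b x => rfl

instance : (envTensorFunctor k A).Additive where
  map_add {M M' f g} := by
    ext1
    exact envTensor_hom_ext k A fun b x =>
      congrArg Submodule.Quotient.mk (TensorProduct.tmul_add b (f.hom x) (g.hom x))

variable {k A}

/-- The tensor product over `A` of two complexes of `A`-bimodules (the total complex). -/
def tensorComplex (K L : CochainComplex (Bimod k A) ℤ) : CochainComplex (Bimod k A) ℤ :=
  CochainComplex.mapBifunctor K L (tensorBifunctor k A)

/-- `tensorPowSucc P n` is the `(n + 1)`-st tensor power `P ⊗_A ⋯ ⊗_A P` of a complex. -/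
def tensorPowSucc (P : CochainComplex (Bimod k A) ℤ) : ℕ → CochainComplex (Bimod k A) ℤ
  | 0 => P
  | n + 1 => tensorComplex (tensorPowSucc P n) P

/-- The complex `A ⊗_{Aᵉ} K` of vector spaces. -/
def envTensorComplex (K : CochainComplex (Bimod k A) ℤ) : CochainComplex (ModuleCat.{u} k) ℤ :=
  ((envTensorFunctor k A).mapHomologicalComplex (ComplexShape.up ℤ)).obj K

/-- The dimension of the total cohomology of a complex of vector spaces. -/
def tdim (V : CochainComplex (ModuleCat.{u} k) ℤ) : ENNReal :=
  ∑' i : ℤ, ((Module.rank k (V.homology i : ModuleCat.{u} k)).toENat : ENNReal)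

/-- A bounded complex `P` of finitely generated projective `A`-bimodules with a quasi-isomorphism
`P ⟶ M`. The complex `M` is perfect if and only if it has such a resolution. -/
structure PerfectResolution (M : CochainComplex (Bimod k A) ℤ) where
  P : CochainComplex (Bimod k A) ℤ
  bounded : {i : ℤ | ¬ Limits.IsZero (P.X i)}.Finite
  finite : ∀ i, Module.Finite (Env k A) (P.X i)
  projective : ∀ i, Module.Projective (Env k A) (P.X i)
  π : P ⟶ M
  quasiIso : QuasiIso π

/-- The Hochschild homology entropy
`limsup_{n → ∞} (1/n) log tdim (A ⊗ᴸ_{Aᵉ} (M ⊗ᴸ_A ⋯ ⊗ᴸ_A M))` (with `n ≥ 1` factors `M`) of a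
perfect bimodule complex `M`, computed from a resolution `P` of `M`: the terms of `P` are projective
as bimodules, hence on each side, so `P ⊗_A ⋯ ⊗_A P` is the derived tensor power of `M`; it is again
a bounded complex of projective bimodules, so `A ⊗_{Aᵉ} -` of it is the derived tensor product. -/
def PerfectResolution.hhEntropy {M : CochainComplex (Bimod k A) ℤ} (R : PerfectResolution M) :
    EReal :=
  Filter.limsup
    (fun n : ℕ =>
      ENNReal.log (tdim (envTensorComplex (tensorPowSucc R.P n))) / ((n + 1 : ℕ) : EReal))
    Filter.atTop

/-! ### Cartan and Coxeter matrices -/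

/-- The Cartan matrix of a finite-dimensional bimodule `X`: the `(i, j)` entry is
`dim (e_j X e_i)`, where `e_j X e_i` is the image of `x ↦ e_j x e_i`. -/
def cartanMatrix {r : ℕ} (e : Fin r → A) (X : Bimod k A) : Matrix (Fin r) (Fin r) ℤ :=
  Matrix.of fun i j => (Module.finrank k (LinearMap.range
    (Algebra.lsmul k k X (e j ⊗ₜ[k] MulOpposite.op (e i) : Env k A))) : ℤ)

/-- The Cartan matrix `∑ₗ (-1)ˡ C_{Hˡ(M)}` of a bimodule complex `M` of finite-dimensional total
cohomology. -/
def cartanMatrixComplex {r : ℕ} (e : Fin r → A) (M : CochainComplex (Bimod k A) ℤ) :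
    Matrix (Fin r) (Fin r) ℤ :=
  ∑ᶠ l : ℤ, (l.negOnePow : ℤ) • cartanMatrix e (M.homology l)

variable (k A) in
/-- `A` as a bimodule over itself, `(a ⊗ a'ᵒᵖ) • x = a x a'`. -/
def regularBimodule : Bimod k A :=
  letI : Module (Env k A) A := TensorProduct.Algebra.module
  ModuleCat.of (Env k A) A

variable (k) in
/-- The Cartan matrix of the algebra `A`. -/
def cartanMatrixAlgebra {r : ℕ} (e : Fin r → A) : Matrix (Fin r) (Fin r) ℤ :=
  cartanMatrix e (regularBimodule k A)

/-- The dual Coxeter matrix `-C_M C_A⁻¹` of a bimodule complex `M`. -/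
def dualCoxeterMatrix {r : ℕ} (e : Fin r → A) (M : CochainComplex (Bimod k A) ℤ) :
    Matrix (Fin r) (Fin r) ℤ :=
  -(cartanMatrixComplex e M * (cartanMatrixAlgebra k e)⁻¹)

/-- The spectral radius of an integer matrix: the largest modulus of a complex eigenvalue
(`0` for the empty matrix). -/
def matrixSpectralRadius {r : ℕ} (C : Matrix (Fin r) (Fin r) ℤ) : ENNReal :=
  spectralRadius ℂ (C.map (Int.cast : ℤ → ℂ))

end Bundled

/-! ### Classes of algebras -/

/-- The algebra `A` is elementary: `A / rad A` is a finite product of copies of `k`. -/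
def IsElementary (k A : Type u) [Field k] [Ring A] [Algebra k A] : Prop :=
  ∃ r : ℕ, Nonempty ((A ⧸ Ring.jacobson A) ≃ₐ[k] (Fin r → k))

/-- The ring `A` has finite (right) global dimension: the projective dimensions of right
`A`-modules are bounded. -/
def FiniteGlobalDimension (A : Type u) [Ring A] : Prop :=
  ∃ d : ℕ, ∀ X : ModuleCat.{u} Aᵐᵒᵖ, HasProjectiveDimensionLE X d

/-- A primitive idempotent: a nonzero idempotent that is not a sum of two nonzero orthogonal
idempotents. -/
def IsPrimitiveIdempotent {A : Type u} [Ring A] (e : A) : Prop :=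
  IsIdempotentElem e ∧ e ≠ 0 ∧ ∀ f g : A, IsIdempotentElem f → IsIdempotentElem g →
    f * g = 0 → g * f = 0 → f + g = e → f = 0 ∨ g = 0

end HHEntropy

end

/-!
Since `A` is elementary, so is its enveloping algebra `Aᵉ`, with the primitive idempotents
`e_j ⊗ e_i`; hence every finitely generated projective bimodule is a direct sum of bimodules
`A e_j ⊗ e_i A`. On these one computes, with `C = C_A`, that `C_{X ⊗_A P} = C_P C⁻¹ C_X` and
`dim (A ⊗_{Aᵉ} (X ⊗_A P)) = tr (C_P C⁻¹ C_X C⁻¹)` for every bimodule `X`; the matrix `C` is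
invertible because the simple modules have finite projective resolutions.

Taking alternating sums over a bounded complex `P` of projectives resolving `M`, the Euler
characteristic of `A ⊗_{Aᵉ} P^{⊗ n}` becomes `tr ((C_M C⁻¹) ^ n) = ± tr (Ψ_M ^ n)` for `n ≥ 2`, so
`|tr (Ψ_M ^ n)|` is a lower bound for the total dimension of the Hochschild homology of `M^{⊗ n}`.
Finally, for infinitely many `n` the powers `μ ^ n` of all eigenvalues of `Ψ_M` point to the right
half plane simultaneously, and then the trace is at least `ρ(Ψ_M) ^ n / 2`.
-/

noncomputable section

namespace HHEntropy

/-! ### Ranks of linear maps -/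

section LinearRank

variable {k V V' W W' : Type*} [Field k] [AddCommGroup V] [Module k V] [AddCommGroup V']
  [Module k V'] [AddCommGroup W] [Module k W] [AddCommGroup W'] [Module k W']

/-- The rank of a linear map as a natural number, `0` if the rank is infinite. -/
def linearRank (f : V →ₗ[k] W) : ℕ := Module.finrank k (LinearMap.range f)

theorem linearRank_id : linearRank (LinearMap.id : V →ₗ[k] V) = Module.finrank k V := by
  rw [linearRank, LinearMap.range_id, finrank_top]

theorem linearRank_comp_of_injective {g : W →ₗ[k] W'} (hg : Function.Injective g)
    (f : V →ₗ[k] W) : linearRank (g ∘ₗ f) = linearRank f := by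
  rw [linearRank, LinearMap.range_comp]
  exact (Submodule.equivMapOfInjective g hg _).finrank_eq.symm

theorem linearRank_comp_of_surjective (g : V' →ₗ[k] W) {f : V →ₗ[k] V'}
    (hf : Function.Surjective f) : linearRank (g ∘ₗ f) = linearRank g := by
  rw [linearRank, LinearMap.range_comp_of_range_eq_top g (LinearMap.range_eq_top.2 hf), linearRank]

theorem linearRank_eq_of_comp_eq_comp {f : V →ₗ[k] W} {f' : V' →ₗ[k] W'} (e : V ≃ₗ[k] V')
    (e' : W ≃ₗ[k] W') (h : f' ∘ₗ e.toLinearMap = e'.toLinearMap ∘ₗ f) :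
    linearRank f = linearRank f' := by
  rw [← linearRank_comp_of_surjective f' (f := e.toLinearMap) e.surjective, h,
    linearRank_comp_of_injective (g := e'.toLinearMap) e'.injective]

theorem linearRank_comp_comm {f : V →ₗ[k] W} {g : W →ₗ[k] V} (h : f ∘ₗ g ∘ₗ f = f) :
    linearRank (f ∘ₗ g) = linearRank (g ∘ₗ f) := by
  have hfgf : ∀ v, f (g (f v)) = f v := LinearMap.congr_fun h
  have hinj : Function.Injective (g.domRestrict (LinearMap.range (f ∘ₗ g))) := by
    rintro ⟨_, x, rfl⟩ ⟨_, y, rfl⟩ hxy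
    simpa [hfgf] using congrArg f hxy
  have hrange : LinearMap.range (g.domRestrict (LinearMap.range (f ∘ₗ g)))
      = LinearMap.range (g ∘ₗ f) := by
    apply le_antisymm
    · rintro _ ⟨⟨_, x, rfl⟩, rfl⟩
      exact ⟨g x, rfl⟩
    · rintro _ ⟨v, rfl⟩
      exact ⟨⟨f v, f v, hfgf v⟩, rfl⟩
  rw [linearRank, linearRank, ← hrange, LinearMap.finrank_range_of_inj hinj]

theorem linearRank_tensorMap (f : V →ₗ[k] V') (g : W →ₗ[k] W') :
    linearRank (TensorProduct.map f g) = linearRank f * linearRank g := by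
  have hfactor : TensorProduct.map f g =
      TensorProduct.map (LinearMap.range f).subtype (LinearMap.range g).subtype ∘ₗ
        TensorProduct.map f.rangeRestrict g.rangeRestrict := by
    rw [← TensorProduct.map_comp]
    rfl
  have hsurj : Function.Surjective (TensorProduct.map f.rangeRestrict g.rangeRestrict) :=
    TensorProduct.map_surjective f.surjective_rangeRestrict g.surjective_rangeRestrict
  have hinj : Function.Injective
      (TensorProduct.map (LinearMap.range f).subtype (LinearMap.range g).subtype) := by
    rw [← LinearMap.lTensor_comp_rTensor]
    exact (Module.Flat.lTensor_preserves_injective_linearMap _ (Submodule.injective_subtype _)).comp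
      (Module.Flat.rTensor_preserves_injective_linearMap _ (Submodule.injective_subtype _))
  rw [hfactor, linearRank_comp_of_surjective _ hsurj, linearRank,
    LinearMap.finrank_range_of_inj hinj, Module.finrank_tensorProduct, linearRank, linearRank]

theorem finrank_eq_sum_linearRank [FiniteDimensional k V] {ι : Type*} [Fintype ι]
    {p : ι → Module.End k V} (hp : CompleteOrthogonalIdempotents p) :
    Module.finrank k V = ∑ i, linearRank (p i) := by
  have hsum : ∀ v, ∑ i, p i v = v := fun v => by
    simpa using LinearMap.congr_fun hp.complete v
  let φ : V →ₗ[k] (∀ i, LinearMap.range (p i)) := LinearMap.pi fun i => (p i).rangeRestrict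
  have hφ : Function.Bijective φ := by
    refine ⟨fun v w hvw => ?_, fun y => ?_⟩
    · rw [← hsum v, ← hsum w]
      exact Finset.sum_congr rfl fun i _ => congrArg Subtype.val (congrFun hvw i)
    · choose x hx using fun i => (y i).2
      refine ⟨∑ j, p j (x j), funext fun i => Subtype.ext ?_⟩
      change p i (∑ j, p j (x j)) = y i
      rw [map_sum, Finset.sum_eq_single i, ← Module.End.mul_apply, (hp.idem i).eq, hx]
      · intro j _ hji
        rw [← Module.End.mul_apply, hp.ortho hji.symm, LinearMap.zero_apply]
      · simp
  rw [(LinearEquiv.ofBijective φ hφ).finrank_eq, Module.finrank_pi_fintype]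
  rfl

end LinearRank

section AdditiveFunctor

variable {k : Type*} [Field k] {𝒞 : Type*} [Category 𝒞] [Preadditive 𝒞]
  (F : 𝒞 ⥤ ModuleCat.{u} k) [F.Additive] {X : 𝒞} {ι : Type*} [Fintype ι] {Y : ι → 𝒞}
  {f : ∀ i, Y i ⟶ X} {g : ∀ i, X ⟶ Y i}

theorem finiteDimensional_obj_of_sum_comp_eq_id (hsum : ∑ i, g i ≫ f i = 𝟙 X)
    [∀ i, FiniteDimensional k (F.obj (Y i))] : FiniteDimensional k (F.obj X) := by
  classical
  refine Module.Finite.of_surjective (LinearMap.lsum k _ k fun i => (F.map (f i)).hom) fun x =>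
    ⟨fun i => (F.map (g i)).hom x, ?_⟩
  simpa [Functor.map_sum, ModuleCat.hom_sum] using
    LinearMap.congr_fun (congrArg (fun φ => (F.map φ).hom) hsum) x

theorem finrank_obj_eq_sum_linearRank (hsum : ∑ i, g i ≫ f i = 𝟙 X)
    (hne : ∀ i j, i ≠ j → f i ≫ g j = 0) [FiniteDimensional k (F.obj X)] :
    Module.finrank k (F.obj X) = ∑ i, linearRank (F.map (f i ≫ g i)).hom := by
  have hfgf : ∀ i, f i ≫ g i ≫ f i = f i := fun i => by
    conv_rhs => rw [← Category.comp_id (f i), ← hsum, Preadditive.comp_sum]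
    rw [Finset.sum_eq_single i _ (by simp)]
    intro j _ hji
    rw [← Category.assoc, hne i j hji.symm, Limits.zero_comp]
  have hp : CompleteOrthogonalIdempotents fun i => (F.map (g i ≫ f i)).hom := by
    refine CompleteOrthogonalIdempotents.mk (OrthogonalIdempotents.mk (fun i => ?_) ?_) ?_
    · change _ ∘ₗ _ = _
      rw [← ModuleCat.hom_comp, ← F.map_comp, Category.assoc, hfgf]
    · intro i j hij
      change _ ∘ₗ _ = _
      rw [← ModuleCat.hom_comp, ← F.map_comp, Category.assoc, ← Category.assoc (f j),
        hne j i hij.symm, Limits.zero_comp, Limits.comp_zero, F.map_zero, ModuleCat.hom_zero]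
    · rw [← ModuleCat.hom_sum, ← F.map_sum, hsum, F.map_id, ModuleCat.hom_id]
      rfl
  rw [finrank_eq_sum_linearRank hp]
  refine Finset.sum_congr rfl fun i _ => ?_
  rw [F.map_comp, F.map_comp, ModuleCat.hom_comp, ModuleCat.hom_comp]
  refine linearRank_comp_comm ?_
  simp only [← ModuleCat.hom_comp, ← F.map_comp, Category.assoc, hfgf]

end AdditiveFunctor

/-! ### Alternating sums and Euler characteristics -/

section AltSum

variable {G H T : Type*} [AddCommGroup G] [AddCommGroup H] [AddCommGroup T]

/-- The alternating sum `∑ₗ (-1)ˡ f l` of a finitely supported family. -/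
def altSum (f : ℤ → G) : G := ∑ᶠ l : ℤ, (l.negOnePow : ℤ) • f l

theorem support_negOnePow_smul_subset (f : ℤ → G) :
    (fun l : ℤ => (l.negOnePow : ℤ) • f l).support ⊆ f.support :=
  Function.support_smul_subset_right (fun l : ℤ => (l.negOnePow : ℤ)) f

theorem altSum_eq_sum {f : ℤ → G} {s : Finset ℤ} (hs : f.support ⊆ s) :
    altSum f = ∑ l ∈ s, (l.negOnePow : ℤ) • f l :=
  finsum_eq_sum_of_support_subset _ ((support_negOnePow_smul_subset f).trans hs)

theorem map_altSum (φ : G →+ H) {f : ℤ → G} (hf : f.support.Finite) :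
    φ (altSum f) = altSum fun l => φ (f l) := by
  have hs : f.support ⊆ hf.toFinset := by simp
  have hs' : (fun l => φ (f l)).support ⊆ hf.toFinset :=
    (Function.support_comp_subset (map_zero φ) f).trans hs
  simp only [altSum_eq_sum hs, altSum_eq_sum hs', map_sum, map_zsmul]

theorem altSum_sub {f g : ℤ → G} (hf : f.support.Finite) (hg : g.support.Finite) :
    altSum (fun l => f l - g l) = altSum f - altSum g := by
  unfold altSum
  simp only [smul_sub]
  exact finsum_sub_distrib (hf.subset (support_negOnePow_smul_subset f))
    (hg.subset (support_negOnePow_smul_subset g))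

theorem altSum_finsetSum {ι : Type*} (s : Finset ι) {f : ι → ℤ → G}
    (hf : ∀ i ∈ s, (f i).support.Finite) :
    altSum (fun l => ∑ i ∈ s, f i l) = ∑ i ∈ s, altSum (f i) := by
  unfold altSum
  simp only [Finset.smul_sum]
  exact finsum_sum_comm _ _ fun i hi => (hf i hi).subset (support_negOnePow_smul_subset (f i))

theorem altSum_comp_add (f : ℤ → G) (p : ℤ) :
    altSum (fun l => f (l + p)) = (p.negOnePow : ℤ) • altSum f := by
  unfold altSum
  rw [← finsum_comp_equiv (Equiv.addRight p) (f := fun l : ℤ => (l.negOnePow : ℤ) • f l),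
    ← Units.smul_def, ← DistribMulAction.toAddEquiv_apply, AddEquiv.map_finsum]
  refine finsum_congr fun l => ?_
  have hsign : ((p.negOnePow * (l + p).negOnePow : ℤˣ) : ℤ) = l.negOnePow := by
    rw [Int.negOnePow_add, mul_left_comm, Int.units_mul_self, mul_one]
  rw [DistribMulAction.toAddEquiv_apply, Units.smul_def, smul_smul, Equiv.coe_addRight,
    ← Units.val_mul, hsign]

theorem altSum_comp_sub (f : ℤ → G) (p : ℤ) :
    altSum (fun l => f (l - p)) = (p.negOnePow : ℤ) • altSum f := by
  simpa only [sub_eq_add_neg, Int.negOnePow_neg] using altSum_comp_add f (-p)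

theorem altSum_convolution (φ : G →+ H →+ T) {f : ℤ → G} {g : ℤ → H} {s : Finset ℤ}
    (hs : f.support ⊆ s) (hg : g.support.Finite) :
    altSum (fun n => ∑ p ∈ s, φ (f p) (g (n - p))) = φ (altSum f) (altSum g) := by
  have hφg : ∀ p, (fun n => φ (f p) (g n)).support.Finite := fun p =>
    hg.subset (Function.support_comp_subset (map_zero (φ (f p))) g)
  calc altSum (fun n => ∑ p ∈ s, φ (f p) (g (n - p)))
      = ∑ p ∈ s, altSum fun n => φ (f p) (g (n - p)) := altSum_finsetSum s fun p _ =>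
        (hφg p).preimage (f := fun n : ℤ => n - p) (sub_left_injective).injOn
    _ = ∑ p ∈ s, (p.negOnePow : ℤ) • φ (f p) (altSum g) := Finset.sum_congr rfl fun p _ => by
        rw [altSum_comp_sub (fun n => φ (f p) (g n)), map_altSum (φ (f p)) hg]
    _ = φ (altSum f) (altSum g) := by
        rw [altSum_eq_sum hs, map_sum, AddMonoidHom.finsetSum_apply]
        simp only [map_zsmul, AddMonoidHom.coe_smul, Pi.smul_apply]

end AltSum

section Bounded

variable {𝒞 𝒟 : Type*} [Category 𝒞] [Limits.HasZeroMorphisms 𝒞] [Category 𝒟]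
  [Limits.HasZeroMorphisms 𝒟]

/-- A cochain complex is bounded if all but finitely many of its terms are zero. -/
def IsBoundedComplex (K : CochainComplex 𝒞 ℤ) : Prop := {i | ¬ Limits.IsZero (K.X i)}.Finite

theorem IsBoundedComplex.finite_support {K : CochainComplex 𝒞 ℤ} (hK : IsBoundedComplex K)
    {G : Type*} [Zero G] {f : ℤ → G} (hf : ∀ i, Limits.IsZero (K.X i) → f i = 0) :
    f.support.Finite :=
  hK.subset fun i hi h => hi (hf i h)

theorem IsBoundedComplex.map {K : CochainComplex 𝒞 ℤ} (hK : IsBoundedComplex K) (F : 𝒞 ⥤ 𝒟)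
    [F.PreservesZeroMorphisms] :
    IsBoundedComplex ((F.mapHomologicalComplex (ComplexShape.up ℤ)).obj K) :=
  hK.subset fun _ hi h => hi (F.map_isZero h)

end Bounded

section EulerCharacteristic

variable {k : Type u} [Field k]

theorem finrank_eq_zero_of_isZero {X : ModuleCat.{u} k} (h : Limits.IsZero X) :
    Module.finrank k X = 0 :=
  have := ModuleCat.subsingleton_of_isZero h
  Module.finrank_zero_of_subsingleton

theorem finiteDimensional_homology (S : ShortComplex (ModuleCat.{u} k))
    [FiniteDimensional k S.X₂] : FiniteDimensional k S.homology :=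
  have e : S.homology ≃ₗ[k] (LinearMap.ker S.g.hom ⧸ LinearMap.range S.moduleCatToCycles) :=
    S.moduleCatHomologyIso.toLinearEquiv
  Module.Finite.equiv e.symm

theorem finrank_homology (S : ShortComplex (ModuleCat.{u} k)) [FiniteDimensional k S.X₂] :
    (Module.finrank k S.homology : ℤ)
      = Module.finrank k S.X₂ - linearRank S.f.hom - linearRank S.g.hom := by
  have hboundary : Module.finrank k (LinearMap.range S.moduleCatToCycles)
      = linearRank S.f.hom :=
    (linearRank_comp_of_injective (LinearMap.ker S.g.hom).injective_subtype
      S.moduleCatToCycles).symm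
  have hcycles : linearRank S.g.hom + Module.finrank k (LinearMap.ker S.g.hom)
      = Module.finrank k S.X₂ := LinearMap.finrank_range_add_finrank_ker S.g.hom
  have hquot := Submodule.finrank_quotient_add_finrank (LinearMap.range S.moduleCatToCycles)
  rw [S.moduleCatHomologyIso.toLinearEquiv.finrank_eq]
  change (Module.finrank k (LinearMap.ker S.g.hom ⧸ LinearMap.range S.moduleCatToCycles) : ℤ) = _
  omega

variable (V : CochainComplex (ModuleCat.{u} k) ℤ)

theorem finrank_cochainComplex_homology (i : ℤ) [FiniteDimensional k (V.X i)] :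
    (Module.finrank k (V.homology i) : ℤ) = Module.finrank k (V.X i)
        - linearRank (V.d (i - 1) i).hom - linearRank (V.d i (i + 1)).hom := by
  have e : V.homology i ≅ (V.sc' (i - 1) i (i + 1)).homology :=
    ShortComplex.homologyMapIso (V.isoSc' (i - 1) i (i + 1) (by simp) (by simp))
  have : FiniteDimensional k (V.sc' (i - 1) i (i + 1)).X₂ := ‹FiniteDimensional k (V.X i)›
  exact e.toLinearEquiv.finrank_eq ▸ finrank_homology (V.sc' (i - 1) i (i + 1))

variable {V} (hb : IsBoundedComplex V)
include hb

theorem altSum_finrank_homology [∀ i, FiniteDimensional k (V.X i)] :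
    altSum (fun i => (Module.finrank k (V.homology i) : ℤ))
      = altSum fun i => (Module.finrank k (V.X i) : ℤ) := by
  let n : ℤ → ℤ := fun i => Module.finrank k (V.X i)
  let b : ℤ → ℤ := fun i => linearRank (V.d (i - 1) i).hom
  have hnfin : n.support.Finite := hb.finite_support fun i hi => by
    simp only [n, finrank_eq_zero_of_isZero hi, Nat.cast_zero]
  have hbfin : b.support.Finite := hb.finite_support fun i hi => by
    have : linearRank (V.d (i - 1) i).hom ≤ Module.finrank k (V.X i) := Submodule.finrank_le _
    simp only [b]
    rw [finrank_eq_zero_of_isZero hi] at this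
    omega
  calc altSum (fun i => (Module.finrank k (V.homology i) : ℤ))
      = altSum (fun i => (n i - b i) - b (i + 1)) := by
        congr 1
        funext i
        simp only [n, b]
        rw [finrank_cochainComplex_homology V i, add_sub_cancel_right]
    _ = altSum n - altSum b - altSum fun i => b (i + 1) := by
        rw [altSum_sub ((hnfin.union hbfin).subset (Function.support_sub n b))
          (hbfin.preimage (add_left_injective 1).injOn), altSum_sub hnfin hbfin]
    _ = altSum n := by
        rw [altSum_comp_add, Int.negOnePow_one]
        simp

theorem natAbs_altSum_finrank_le_tdim [∀ i, FiniteDimensional k (V.X i)] :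
    ((altSum fun i => (Module.finrank k (V.X i) : ℤ)).natAbs : ENNReal) ≤ tdim V := by
  have hsupp : (fun i => (Module.finrank k (V.homology i) : ℤ)).support.Finite :=
    hb.finite_support fun i hi => by
      have := finrank_cochainComplex_homology V i
      rw [finrank_eq_zero_of_isZero hi] at this
      omega
  rw [← altSum_finrank_homology hb, altSum_eq_sum (s := hsupp.toFinset) (by simp)]
  calc ((∑ l ∈ hsupp.toFinset, (l.negOnePow : ℤ) • (Module.finrank k (V.homology l) : ℤ)).natAbs :
        ENNReal)
      ≤ ((∑ l ∈ hsupp.toFinset, Module.finrank k (V.homology l) : ℕ) : ENNReal) := by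
        norm_cast
        refine (Int.natAbs_sum_le _ _).trans (Finset.sum_le_sum fun l _ => ?_)
        simp [Int.natAbs_mul]
    _ = ∑ l ∈ hsupp.toFinset, ((Module.rank k (V.homology l)).toENat : ENNReal) := by
        push_cast
        refine Finset.sum_congr rfl fun l _ => ?_
        have : FiniteDimensional k (V.sc l).X₂ := inferInstanceAs (FiniteDimensional k (V.X l))
        have : FiniteDimensional k (V.homology l) := finiteDimensional_homology (V.sc l)
        rw [← Module.finrank_eq_rank, Cardinal.toENat_nat]
        rfl
    _ ≤ tdim V := ENNReal.sum_le_tsum _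

end EulerCharacteristic

/-! ### Projective modules over split basic algebras -/

section Jacobson

variable {B : Type*} [Ring B]

theorem mem_jacobson_of_forall_isNilpotent_mul {x : B} (hx : ∀ y, IsNilpotent (y * x)) :
    x ∈ Ring.jacobson B := by
  rw [← Ideal.jacobson_bot, Ideal.mem_jacobson_iff]
  intro y
  obtain ⟨u, hu⟩ := (hx y).isUnit_one_add
  refine ⟨↑u⁻¹, ?_⟩
  have : ↑u⁻¹ * y * x + ↑u⁻¹ - 1 = ↑u⁻¹ * (1 + y * x) - (1 : B) := by noncomm_ring
  rw [this, ← hu, Units.inv_mul, sub_self]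
  exact zero_mem _

theorem mem_ideal_smul_top_of_forall_dual {P : Type*} [AddCommGroup P] [Module B P]
    [Module.Projective B P] {I : Ideal B} {q : P} (hq : ∀ φ : P →ₗ[B] B, φ q ∈ I) :
    q ∈ I • (⊤ : Submodule B P) := by
  obtain ⟨s, hs⟩ := Module.projective_def.1 (inferInstance : Module.Projective B P)
  rw [← hs q, Finsupp.linearCombination_apply]
  exact Submodule.sum_mem _ fun x _ =>
    Submodule.smul_mem_smul (hq (Finsupp.lapply x ∘ₗ s)) Submodule.mem_top

end Jacobson

/-- The algebra `B` is split basic: modulo a nil ideal it is a product of copies of `k` (by way of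
`π`), and `ε` is a complete family of orthogonal idempotents lifting the standard ones. -/
structure IsSplitBasic {k B ι : Type*} [Field k] [Ring B] [Algebra k B] [Fintype ι]
    [DecidableEq ι] (ε : ι → B) (π : B →ₐ[k] (ι → k)) : Prop where
  complete : CompleteOrthogonalIdempotents ε
  map_single : ∀ i, π (ε i) = Pi.single i 1
  isNilpotent_of_map_eq_zero : ∀ b, π b = 0 → IsNilpotent b

/-- Vectors `p j` and functionals `ψ j` exhibiting the `B`-module `P` as the direct sum of the left
ideals `B ε (i j)`, for a family `ε` of idempotents of `B`. -/
structure IsDualBasis {B ι J P : Type*} [Ring B] [AddCommGroup P] [Module B P] [Fintype J]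
    (ε : ι → B) (i : J → ι) (p : J → P) (ψ : J → P →ₗ[B] B) : Prop where
  apply_self : ∀ j, ψ j (p j) = ε (i j)
  apply_ne : ∀ j j', j ≠ j' → ψ j' (p j) = 0
  sum_smul : ∀ x, ∑ j, ψ j x • p j = x

namespace IsDualBasis

theorem option {B ι J P : Type*} [Ring B] [AddCommGroup P] [Module B P] [Fintype J] {ε : ι → B}
    {i₀ : ι} {p₀ : P} {ψ₀ : P →ₗ[B] B} {ρ : P →ₗ[B] LinearMap.ker ψ₀} {i : J → ι}
    {p : J → LinearMap.ker ψ₀} {ψ : J → LinearMap.ker ψ₀ →ₗ[B] B} (h : IsDualBasis ε i p ψ)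
    (hp₀ : ε i₀ • p₀ = p₀) (hψ₀ : ψ₀ p₀ = ε i₀) (hρ : ∀ x, (ρ x : P) = x - ψ₀ x • p₀) :
    IsDualBasis ε (fun j : Option J => j.elim i₀ i) (fun j => j.elim p₀ fun j => p j)
      (fun j => j.elim ψ₀ fun j => ψ j ∘ₗ ρ) := by
  have hρp₀ : ρ p₀ = 0 := Subtype.ext (by rw [hρ, hψ₀, hp₀, sub_self]; rfl)
  have hρker : ∀ y : LinearMap.ker ψ₀, ρ y = y := fun y =>
    Subtype.ext (by rw [hρ, LinearMap.mem_ker.1 y.2, zero_smul, sub_zero])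
  refine ⟨?_, ?_, fun x => ?_⟩
  · rintro (_ | j)
    · exact hψ₀
    · exact (congrArg (ψ j) (hρker (p j))).trans (h.apply_self j)
  · rintro (_ | j) (_ | j') hne
    · exact absurd rfl hne
    · exact (congrArg (ψ j') hρp₀).trans (map_zero _)
    · exact (p j).2
    · exact (congrArg (ψ j') (hρker (p j))).trans
        (h.apply_ne j j' fun hjj' => hne (congrArg some hjj'))
  · have hx := congrArg Subtype.val (h.sum_smul (ρ x))
    rw [hρ, AddSubmonoidClass.coe_finsetSum] at hx
    rw [Fintype.sum_option]
    exact (congrArg (ψ₀ x • p₀ + ·) hx).trans (add_sub_cancel _ _)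

end IsDualBasis

namespace IsSplitBasic

variable {k B ι : Type*} [Field k] [Ring B] [Algebra k B] [Fintype ι] [DecidableEq ι]
  {ε : ι → B} {π : B →ₐ[k] (ι → k)} (h : IsSplitBasic ε π)
include h

theorem mem_jacobson_of_map_eq_zero {b : B} (hb : π b = 0) : b ∈ Ring.jacobson B :=
  mem_jacobson_of_forall_isNilpotent_mul fun y =>
    h.isNilpotent_of_map_eq_zero _ (by rw [map_mul, hb, mul_zero])

theorem exists_mul_eq_idempotent {i : ι} {y : B} (hy : ε i * y = y) (hy0 : π y ≠ 0) :
    ∃ z, y * z = ε i := by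
  have hπ : π y = (π y i) • (Pi.single i 1 : ι → k) := by
    conv_lhs => rw [← hy, map_mul, h.map_single]
    ext j
    rcases eq_or_ne j i with rfl | hj <;> simp [*]
  have hc : π y i ≠ 0 := fun hc => hy0 (by rw [hπ, hc, zero_smul])
  have hnil : IsNilpotent ((π y i)⁻¹ • y - ε i) := by
    apply h.isNilpotent_of_map_eq_zero
    rw [map_sub, map_smul, hπ, h.map_single, smul_smul]
    simp [hc]
  obtain ⟨u, hu⟩ := hnil.isUnit_one_add
  have hεu : ε i * u = (π y i)⁻¹ • y := by
    rw [hu, mul_add, mul_one, mul_sub, mul_smul_comm, hy, (h.complete.idem i).eq,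
      add_sub_cancel]
  refine ⟨(π y i)⁻¹ • ↑u⁻¹, ?_⟩
  rw [mul_smul_comm, ← smul_mul_assoc, ← hεu, Units.mul_inv_cancel_right]

theorem ne_zero (i : ι) : ε i ≠ 0 := fun h0 => by
  simpa [h0] using congrFun (h.map_single i) i

theorem exists_dual_pair (P : Type*) [AddCommGroup P] [Module B P] [Module.Finite B P]
    [Module.Projective B P] [Nontrivial P] : ∃ (i : ι) (p : P) (ψ : P →ₗ[B] B),
    ε i • p = p ∧ ψ p = ε i ∧ ∀ x, ψ x * ε i = ψ x := by
  obtain ⟨q, -, hq⟩ := SetLike.exists_of_lt (Submodule.jacobson_smul_lt_top (R := B) (M := P) ⊤)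
  obtain ⟨i, hi⟩ : ∃ i, ε i • q ∉ Ring.jacobson B • (⊤ : Submodule B P) := by
    by_contra! hcon
    apply hq
    rw [← one_smul B q, ← h.complete.complete, Finset.sum_smul]
    exact Submodule.sum_mem _ fun i _ => hcon i
  obtain ⟨φ, hφ⟩ : ∃ φ : P →ₗ[B] B, π (φ (ε i • q)) ≠ 0 := by
    by_contra! hcon
    exact hi (mem_ideal_smul_top_of_forall_dual fun φ => h.mem_jacobson_of_map_eq_zero (hcon φ))
  have hid := (h.complete.idem i).eq
  obtain ⟨z, hz⟩ := h.exists_mul_eq_idempotent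
    (by rw [← smul_eq_mul, ← map_smul, smul_smul, hid]) hφ
  refine ⟨i, ε i • q, LinearMap.toSpanSingleton B B (z * ε i) ∘ₗ φ, ?_, ?_, fun x => ?_⟩
  · rw [smul_smul, hid]
  · rw [LinearMap.comp_apply, LinearMap.toSpanSingleton_apply, smul_eq_mul, ← mul_assoc, hz, hid]
  · simp only [LinearMap.comp_apply, LinearMap.toSpanSingleton_apply, smul_eq_mul, mul_assoc, hid]

theorem exists_isDualBasis [FiniteDimensional k B] (P : Type*) [AddCommGroup P] [Module B P]
    [Module.Finite B P] [Module.Projective B P] :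
    ∃ (J : Type) (_ : Fintype J) (i : J → ι) (p : J → P) (ψ : J → P →ₗ[B] B),
      IsDualBasis ε i p ψ := by
  have : IsArtinianRing B := IsArtinianRing.of_finite k B
  induction hn : Module.length B P using WellFoundedLT.induction generalizing P with
  | _ n ih =>
    rcases subsingleton_or_nontrivial P with hP | hP
    · exact ⟨Empty, inferInstance, Empty.elim, Empty.rec, Empty.rec, Empty.rec, fun j => j.elim,
        fun x => Subsingleton.elim _ _⟩
    obtain ⟨i₀, p₀, ψ₀, hp₀, hψ₀, hψε⟩ := h.exists_dual_pair P
    let ρ : P →ₗ[B] LinearMap.ker ψ₀ :=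
      (LinearMap.id - LinearMap.toSpanSingleton B P p₀ ∘ₗ ψ₀).codRestrict _ fun x => by
        simp [hψ₀, hψε]
    have hρ : ∀ x, (ρ x : P) = x - ψ₀ x • p₀ := fun x => rfl
    have hρker : ρ ∘ₗ (LinearMap.ker ψ₀).subtype = LinearMap.id := LinearMap.ext fun y =>
      Subtype.ext (by simp [hρ])
    have : Module.Finite B (LinearMap.ker ψ₀) :=
      Module.Finite.of_surjective ρ fun y => ⟨y, LinearMap.congr_fun hρker y⟩
    have : Module.Projective B (LinearMap.ker ψ₀) := Module.Projective.of_split _ ρ hρker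
    have hlt : Module.length B (LinearMap.ker ψ₀) < n := by
      rw [← hn]
      refine Submodule.length_lt fun htop => h.ne_zero i₀ ?_
      rw [← hψ₀, LinearMap.ker_eq_top.1 htop, LinearMap.zero_apply]
    obtain ⟨J, _, i, p, ψ, hJ⟩ := ih _ hlt _ rfl
    exact ⟨Option J, inferInstance, _, _, _, hJ.option hp₀ hψ₀ hρ⟩

end IsSplitBasic

section Multiplicity

/-- The free left module of rank one. This is not reducible, so that over a `k`-algebra `B` the only
`k`-action in sight is the restriction of scalars. -/
def freeModule (B : Type u) [Ring B] : ModuleCat.{u} B := ModuleCat.of B B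

/-- Right multiplication by `b`, as an endomorphism of the left module `B`. -/
def rightMul {B : Type u} [Ring B] (b : B) : freeModule B ⟶ freeModule B :=
  ModuleCat.ofHom (LinearMap.toSpanSingleton B B b)

variable {k : Type*} {B : Type u} {ι : Type*} [Field k] [Ring B]

theorem IsDualBasis.finrank_obj_eq_sum {ε : ι → B} {J : Type*} [Fintype J] {i : J → ι}
    {P : ModuleCat.{u} B} {p : J → P} {ψ : J → P →ₗ[B] B} (h : IsDualBasis ε i p ψ)
    (F : ModuleCat.{u} B ⥤ ModuleCat.{u} k) [F.Additive] [FiniteDimensional k (F.obj P)] :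
    Module.finrank k (F.obj P) = ∑ j, linearRank (F.map (rightMul (ε (i j)))).hom := by
  let f : J → (freeModule B ⟶ P) := fun j => ModuleCat.ofHom (LinearMap.toSpanSingleton B P (p j))
  let g : J → (P ⟶ freeModule B) := fun j => ModuleCat.ofHom (ψ j)
  have hcomp : ∀ j j', f j ≫ g j' = rightMul (ψ j' (p j)) := fun j j' =>
    ModuleCat.hom_ext (LinearMap.ext fun b : B => map_smul (ψ j') b (p j))
  rw [finrank_obj_eq_sum_linearRank F (f := f) (g := g)]
  · simp only [hcomp, h.apply_self]
  · ext x
    rw [ModuleCat.hom_sum, LinearMap.sum_apply]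
    exact h.sum_smul x
  · intro j j' hne
    rw [hcomp, h.apply_ne j j' hne]
    exact ModuleCat.hom_ext (LinearMap.ext (mul_zero (M₀ := B)))

/-- `P` is a direct sum of `N i` copies of the projective modules `B (ε i)`. This is encoded by its
consequence for the dimensions of the values of additive functors. -/
def IsMultiplicity (k : Type*) [Field k] {ι : Type*} [Fintype ι] (ε : ι → B) (P : ModuleCat.{u} B)
    (N : ι → ℕ) : Prop :=
  ∀ (F : ModuleCat.{u} B ⥤ ModuleCat.{u} k) [F.Additive] [FiniteDimensional k (F.obj P)],
    Module.finrank k (F.obj P) = ∑ i, N i * linearRank (F.map (rightMul (ε i))).hom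

theorem IsSplitBasic.exists_isMultiplicity [Algebra k B] [FiniteDimensional k B] [Fintype ι]
    [DecidableEq ι] {ε : ι → B} {π : B →ₐ[k] (ι → k)} (h : IsSplitBasic ε π) (P : ModuleCat.{u} B)
    [Module.Finite B P] [Module.Projective B P] : ∃ N : ι → ℕ, IsMultiplicity k ε P N := by
  classical
  obtain ⟨J, _, i, p, ψ, hJ⟩ := h.exists_isDualBasis P
  refine ⟨fun l => (Finset.univ.filter fun j => i j = l).card, fun F _ _ => ?_⟩
  rw [hJ.finrank_obj_eq_sum F, ← Finset.sum_fiberwise Finset.univ i]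
  refine Finset.sum_congr rfl fun l _ => ?_
  rw [Finset.sum_congr rfl fun j hj => by rw [(Finset.mem_filter.1 hj).2], Finset.sum_const,
    smul_eq_mul]

end Multiplicity

/-! ### Elementary algebras and their enveloping algebras -/

section Elementary

variable {k A : Type u} [Field k] [Ring A] [Algebra k A]

theorem IsElementary.exists_algHom [FiniteDimensional k A] (h : IsElementary k A) :
    ∃ (m : ℕ) (ρ : A →ₐ[k] (Fin m → k)),
      Function.Surjective ρ ∧ ∀ a, ρ a = 0 → IsNilpotent a := by
  have : IsArtinianRing A := IsArtinianRing.of_finite k A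
  obtain ⟨n, hn⟩ := IsSemiprimaryRing.isNilpotent (R := A)
  obtain ⟨m, ⟨φ⟩⟩ := h
  refine ⟨m, φ.toAlgHom.comp (Ideal.Quotient.mkₐ k (Ring.jacobson A)),
    φ.surjective.comp Ideal.Quotient.mk_surjective, fun a ha => ⟨n, ?_⟩⟩
  have ha : a ∈ Ring.jacobson A :=
    Ideal.Quotient.eq_zero_iff_mem.1 (φ.injective (ha.trans (map_zero φ).symm))
  simpa [hn] using Ideal.pow_mem_pow ha n

theorem IsPrimitiveIdempotent.eq_of_mul_eq {e f : A} (he : IsPrimitiveIdempotent e)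
    (hf : IsIdempotentElem f) (hf0 : f ≠ 0) (hef : e * f = f) (hfe : f * e = f) : e = f := by
  have hsub : IsIdempotentElem (e - f) := by
    rw [IsIdempotentElem, mul_sub, sub_mul, sub_mul, he.1.eq, hef, hfe, hf.eq, sub_self, sub_zero]
  refine sub_eq_zero.1 ((he.2.2 f (e - f) hf hsub ?_ ?_ (add_sub_cancel f e)).resolve_left hf0)
  · rw [mul_sub, hfe, hf.eq, sub_self]
  · rw [sub_mul, hef, hf.eq, sub_self]

theorem IsPrimitiveIdempotent.exists_map_eq_single {ι : Type*} [DecidableEq ι] {e : A}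
    (he : IsPrimitiveIdempotent e) {ρ : A →ₐ[k] (ι → k)} (hsurj : Function.Surjective ρ)
    (hnil : ∀ a, ρ a = 0 → IsNilpotent a) : ∃ t, ρ e = Pi.single t 1 := by
  obtain ⟨t, ht⟩ : ∃ t, ρ e t ≠ 0 := by
    by_contra! hcon
    obtain ⟨l, hl⟩ := hnil e (funext hcon)
    exact he.2.1 (by rw [← he.1.pow_succ_eq l, pow_succ, hl, zero_mul])
  have ht1 : ρ e t = 1 := mul_left_cancel₀ ht <| by
    rw [← Pi.mul_apply, ← map_mul, he.1.eq, mul_one]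
  have hs : (Pi.single t 1 : ι → k) * ρ (1 - e) = 0 := by
    ext l
    rcases eq_or_ne l t with rfl | hl <;> simp [*]
  have hidem : IsIdempotentElem (Pi.single t 1 : ι → k) := by
    rw [IsIdempotentElem, ← Pi.single_mul, mul_one]
  obtain ⟨f, hf, hρf, hf1, hf2⟩ := exists_isIdempotentElem_mul_eq_zero_of_ker_isNilpotent
    (ρ : A →+* (ι → k)) hnil (Pi.single t 1) (hsurj _) hidem (1 - e) he.1.one_sub hs
    (by rw [mul_comm]; exact hs)
  rw [mul_sub, mul_one, sub_eq_zero] at hf1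
  rw [sub_mul, one_mul, sub_eq_zero] at hf2
  have hf0 : f ≠ 0 := by
    rintro rfl
    simpa using congrFun hρf t
  exact ⟨t, he.eq_of_mul_eq hf hf0 hf2.symm hf1.symm ▸ hρf⟩

theorem IsSplitBasic.of_map_eq_single {ι κ : Type*} [Fintype ι] [DecidableEq ι] [DecidableEq κ]
    {e : ι → A} (he : CompleteOrthogonalIdempotents e) {ρ : A →ₐ[k] (κ → k)}
    (hnil : ∀ a, ρ a = 0 → IsNilpotent a) {σ : ι → κ} (hσ : ∀ i, ρ (e i) = Pi.single (σ i) 1) :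
    IsSplitBasic e (AlgHom.pi fun i => (Pi.evalAlgHom k (fun _ => k) (σ i)).comp ρ) where
  complete := he
  map_single i := by
    ext j
    rcases eq_or_ne i j with rfl | hij
    · simp [hσ]
    · have h : ρ (e i) (σ j) * ρ (e j) (σ j) = 0 := by
        rw [← Pi.mul_apply, ← map_mul, he.ortho hij, map_zero, Pi.zero_apply]
      simpa [hσ j, hij.symm] using h
  isNilpotent_of_map_eq_zero a ha := by
    refine hnil a (funext fun t => ?_)
    obtain ⟨i, -, hi⟩ : ∃ i ∈ Finset.univ, ρ (e i) t ≠ 0 := by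
      refine Finset.exists_ne_zero_of_sum_ne_zero ?_
      rw [← Finset.sum_apply, ← map_sum, he.complete, map_one]
      exact one_ne_zero
    obtain rfl : t = σ i := by
      by_contra hne
      exact hi (by rw [hσ, Pi.single_eq_of_ne hne])
    exact congrFun ha i

theorem IsElementary.exists_isSplitBasic [FiniteDimensional k A] (h : IsElementary k A)
    {ι : Type*} [Fintype ι] [DecidableEq ι] {e : ι → A} (he : CompleteOrthogonalIdempotents e)
    (hprim : ∀ i, IsPrimitiveIdempotent (e i)) :
    ∃ π : A →ₐ[k] (ι → k), IsSplitBasic e π := by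
  obtain ⟨m, ρ, hsurj, hnil⟩ := h.exists_algHom
  choose σ hσ using fun i => (hprim i).exists_map_eq_single hsurj hnil
  exact ⟨_, IsSplitBasic.of_map_eq_single he hnil hσ⟩

end Elementary

section Nilpotent

variable {k B C : Type*} [CommRing k] [Ring B] [Ring C] [Algebra k B] [Algebra k C]

theorem isNilpotent_of_mem_mul {X Y : Submodule k B} (hXY : Commute X Y) (hX : IsNilpotent X)
    {z : B} (hz : z ∈ X * Y) : IsNilpotent z := by
  obtain ⟨n, hn⟩ := hX
  refine ⟨n, ?_⟩
  have hpow := Submodule.pow_mem_pow (X * Y) hz n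
  rwa [hXY.mul_pow, hn, zero_mul, Submodule.zero_eq_bot, Submodule.mem_bot] at hpow

theorem commute_map_includeLeft_map_includeRight (X : Submodule k B) (Y : Submodule k C) :
    Commute
      (X.map (Algebra.TensorProduct.includeLeft : B →ₐ[k] B ⊗[k] C).toLinearMap)
      (Y.map (Algebra.TensorProduct.includeRight : C →ₐ[k] B ⊗[k] C).toLinearMap) := by
  refine Submodule.mul_comm_of_commute ?_
  rintro _ ⟨b, -, rfl⟩ _ ⟨c, -, rfl⟩
  simp [Commute, SemiconjBy]

theorem includeLeft_mem_jacobson {I : Ideal B} (hI : IsNilpotent (I.restrictScalars k)) {b : B}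
    (hb : b ∈ I) : (b ⊗ₜ[k] (1 : C)) ∈ Ring.jacobson (B ⊗[k] C) := by
  refine mem_jacobson_of_forall_isNilpotent_mul fun y => ?_
  refine isNilpotent_of_mem_mul (commute_map_includeLeft_map_includeRight _ ⊤)
    (hI.map (Submodule.mapHom (Algebra.TensorProduct.includeLeft : B →ₐ[k] B ⊗[k] C))) ?_
  induction y with
  | zero => rw [zero_mul]; exact zero_mem _
  | add x y hx hy => rw [add_mul]; exact add_mem hx hy
  | tmul b' c =>
    have : (b' ⊗ₜ[k] c) * (b ⊗ₜ[k] (1 : C)) = ((b' * b) ⊗ₜ[k] 1) * (1 ⊗ₜ[k] c) := by simp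
    rw [this]
    exact Submodule.mul_mem_mul ⟨_, I.mul_mem_left b' hb, rfl⟩ ⟨c, trivial, rfl⟩

theorem includeRight_mem_jacobson {I : Ideal C} (hI : IsNilpotent (I.restrictScalars k)) {c : C}
    (hc : c ∈ I) : ((1 : B) ⊗ₜ[k] c) ∈ Ring.jacobson (B ⊗[k] C) := by
  refine mem_jacobson_of_forall_isNilpotent_mul fun y => ?_
  refine isNilpotent_of_mem_mul (commute_map_includeLeft_map_includeRight ⊤ _).symm
    (hI.map (Submodule.mapHom (Algebra.TensorProduct.includeRight : C →ₐ[k] B ⊗[k] C))) ?_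
  induction y with
  | zero => rw [zero_mul]; exact zero_mem _
  | add x y hx hy => rw [add_mul]; exact add_mem hx hy
  | tmul b c' =>
    have : (b ⊗ₜ[k] c') * ((1 : B) ⊗ₜ[k] c) = (1 ⊗ₜ[k] (c' * c)) * (b ⊗ₜ[k] 1) := by simp
    rw [this]
    exact Submodule.mul_mem_mul ⟨_, I.mul_mem_left c' hc, rfl⟩ ⟨b, trivial, rfl⟩

end Nilpotent

section PiTensor

variable {k : Type*} [Field k] {ι ι' : Type*} [Finite ι']

theorem piTensor_eq_zero_of_forall_eval_eq_zero {z : (ι → k) ⊗[k] (ι' → k)}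
    (hz : ∀ i j, Algebra.TensorProduct.productMap (Pi.evalAlgHom k (fun _ => k) i)
      (Pi.evalAlgHom k (fun _ => k) j) z = 0) : z = 0 := by
  classical
  have := Fintype.ofFinite ι'
  have hpi : ∀ (z : (ι → k) ⊗[k] (ι' → k)) i j,
      Algebra.TensorProduct.productMap (Pi.evalAlgHom k (fun _ => k) i)
        (Pi.evalAlgHom k (fun _ => k) j) z = TensorProduct.piScalarRight k k (ι → k) ι' z j i := by
    intro z i j
    induction z with
    | zero => simp
    | add x y hx hy => rw [map_add, map_add, hx, hy]; rfl
    | tmul x y => simp [mul_comm]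
  refine (TensorProduct.piScalarRight k k (ι → k) ι').injective ?_
  rw [map_zero]
  ext j i
  rw [← hpi, hz]
  rfl

end PiTensor

namespace IsSplitBasic

variable {k B C ι ι' : Type*} [Field k] [Ring B] [Algebra k B] [Ring C] [Algebra k C] [Fintype ι]
  [DecidableEq ι] [Fintype ι'] [DecidableEq ι'] {ε : ι → B} {π : B →ₐ[k] (ι → k)}
  {ε' : ι' → C} {π' : C →ₐ[k] (ι' → k)}

theorem op (h : IsSplitBasic ε π) : IsSplitBasic (fun i => MulOpposite.op (ε i))
    (AlgHom.fromOpposite π fun x y => Commute.all (π x) (π y)) where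
  complete :=
    { idem := fun i => congrArg MulOpposite.op (h.complete.idem i)
      ortho := fun i j hij => congrArg MulOpposite.op (h.complete.ortho hij.symm)
      complete := by rw [← Finset.op_sum, h.complete.complete, MulOpposite.op_one] }
  map_single i := h.map_single i
  isNilpotent_of_map_eq_zero b hb := by
    obtain ⟨n, hn⟩ := h.isNilpotent_of_map_eq_zero b.unop hb
    exact ⟨n, MulOpposite.unop_injective hn⟩

theorem surjective (h : IsSplitBasic ε π) : Function.Surjective π := fun x => by
  refine ⟨∑ i, x i • ε i, ?_⟩
  ext j
  simp [h.map_single, Pi.single_apply]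

theorem isNilpotent_ker [FiniteDimensional k B] (h : IsSplitBasic ε π) :
    IsNilpotent ((RingHom.ker π).restrictScalars k) := by
  have : IsArtinianRing B := IsArtinianRing.of_finite k B
  obtain ⟨n, hn⟩ := IsSemiprimaryRing.isNilpotent (R := B)
  have hle : RingHom.ker π ≤ Ring.jacobson B := fun b hb => h.mem_jacobson_of_map_eq_zero hb
  have hbot : RingHom.ker π ^ (n + 1) = ⊥ := by
    rw [eq_bot_iff, ← Submodule.zero_eq_bot, ← zero_mul (Ring.jacobson B), ← hn,
      ← Submodule.pow_succ]
    exact Ideal.pow_right_mono hle _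
  refine ⟨n + 1, ?_⟩
  rw [← Submodule.restrictScalars_pow n.succ_ne_zero, hbot, Submodule.restrictScalars_bot,
    Submodule.zero_eq_bot]

theorem complete_tensor (h : IsSplitBasic ε π) (h' : IsSplitBasic ε' π') :
    CompleteOrthogonalIdempotents fun p : ι × ι' => ε p.1 ⊗ₜ[k] ε' p.2 where
  idem p := by
    rw [IsIdempotentElem, Algebra.TensorProduct.tmul_mul_tmul, (h.complete.idem _).eq,
      (h'.complete.idem _).eq]
  ortho p q hpq := by
    change ε p.1 ⊗ₜ[k] ε' p.2 * ε q.1 ⊗ₜ[k] ε' q.2 = 0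
    rw [Algebra.TensorProduct.tmul_mul_tmul]
    by_cases h1 : p.1 = q.1
    · rw [h'.complete.ortho fun h2 => hpq (Prod.ext h1 h2), TensorProduct.tmul_zero]
    · rw [h.complete.ortho h1, TensorProduct.zero_tmul]
  complete := by
    simp only [Fintype.sum_prod_type, ← TensorProduct.tmul_sum, ← TensorProduct.sum_tmul,
      h.complete.complete, h'.complete.complete, Algebra.TensorProduct.one_def]

theorem isNilpotent_of_map_tensor_eq_zero [FiniteDimensional k B] [FiniteDimensional k C]
    (h : IsSplitBasic ε π) (h' : IsSplitBasic ε' π') {z : B ⊗[k] C}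
    (hz : Algebra.TensorProduct.map π π' z = 0) : IsNilpotent z := by
  have : IsArtinianRing (B ⊗[k] C) := IsArtinianRing.of_finite k _
  obtain ⟨n, hn⟩ := IsSemiprimaryRing.isNilpotent (R := B ⊗[k] C)
  have hker : RingHom.ker (Algebra.TensorProduct.map π π') ≤ Ring.jacobson (B ⊗[k] C) := by
    rw [Algebra.TensorProduct.map_ker π π' h.surjective h'.surjective]
    exact sup_le
      (Ideal.map_le_iff_le_comap.2 fun b hb => includeLeft_mem_jacobson h.isNilpotent_ker hb)
      (Ideal.map_le_iff_le_comap.2 fun c hc => includeRight_mem_jacobson h'.isNilpotent_ker hc)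
  exact ⟨n, by simpa [hn] using Ideal.pow_mem_pow (hker hz) n⟩

theorem tensor [FiniteDimensional k B] [FiniteDimensional k C] (h : IsSplitBasic ε π)
    (h' : IsSplitBasic ε' π') : IsSplitBasic (fun p : ι × ι' => ε p.1 ⊗ₜ[k] ε' p.2)
      (AlgHom.pi fun p : ι × ι' => (Algebra.TensorProduct.productMap
        (Pi.evalAlgHom k (fun _ => k) p.1) (Pi.evalAlgHom k (fun _ => k) p.2)).comp
          (Algebra.TensorProduct.map π π')) where
  complete := h.complete_tensor h'
  map_single p := by
    ext q
    simp only [AlgHom.pi_apply, AlgHom.comp_apply, Algebra.TensorProduct.map_tmul, h.map_single,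
      h'.map_single, Algebra.TensorProduct.productMap_apply_tmul, Pi.evalAlgHom_apply,
      Pi.single_apply, Prod.ext_iff]
    split_ifs <;> simp_all
  isNilpotent_of_map_eq_zero z hz := h.isNilpotent_of_map_tensor_eq_zero h' <|
    piTensor_eq_zero_of_forall_eval_eq_zero fun i j => congrFun hz (i, j)

end IsSplitBasic

section EnvIdempotent

/-- The idempotent `e i ⊗ (e j)ᵒᵖ` of the enveloping algebra, for `p = (i, j)`. -/
def envIdempotent (k : Type u) {A : Type u} [Field k] [Ring A] [Algebra k A] {ι : Type*}
    (e : ι → A) (p : ι × ι) : Env k A :=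
  e p.1 ⊗ₜ[k] MulOpposite.op (e p.2)

theorem IsSplitBasic.exists_isSplitBasic_env {k A : Type u} [Field k] [Ring A] [Algebra k A]
    [FiniteDimensional k A] {ι : Type*} [Fintype ι] [DecidableEq ι] {e : ι → A}
    {π : A →ₐ[k] (ι → k)} (h : IsSplitBasic e π) :
    ∃ πe : Env k A →ₐ[k] (ι × ι → k), IsSplitBasic (envIdempotent k e) πe :=
  ⟨_, h.tensor h.op⟩

end EnvIdempotent

/-! ### The functors `X ↦ b X` -/

section Cut

open scoped ModuleCat

variable {k B : Type u} [Field k] [Ring B] [Algebra k B]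

/-- The functor `X ↦ b X` from left `B`-modules to vector spaces, for `b : B`. It is exact when `b`
is idempotent. -/
def cutFunctor (k : Type u) [Field k] [Algebra k B] (b : B) :
    ModuleCat.{u} B ⥤ ModuleCat.{u} k where
  obj X := ModuleCat.of k (LinearMap.range (Algebra.lsmul k k X b))
  map {X Y} f := ModuleCat.ofHom
    { toFun := fun x => ⟨f.hom x, by
        obtain ⟨y, hy⟩ := x.2
        exact ⟨f.hom y, ((map_smul f.hom b y).symm.trans (congrArg f.hom hy) :)⟩⟩
      map_add' := fun x y => Subtype.ext (map_add f.hom (x : X) y)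
      map_smul' := fun c x => Subtype.ext (map_smul f.hom (algebraMap k B c) (x : X)) }

instance (b : B) : (cutFunctor k b).Additive where
  map_add := rfl

theorem cutFunctor_exact {b : B} (hb : IsIdempotentElem b) (S : ShortComplex (ModuleCat.{u} B))
    (hS : S.Exact) : (S.map (cutFunctor k b)).Exact := by
  rw [ShortComplex.moduleCat_exact_iff] at hS ⊢
  rintro ⟨_, y, rfl⟩ hgy
  obtain ⟨x, hx⟩ := hS (b • y) (congrArg Subtype.val hgy)
  refine ⟨⟨b • x, ⟨x, rfl⟩⟩, Subtype.ext ?_⟩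
  exact ((map_smul S.f.hom b x).trans (congrArg (b • ·) hx)).trans (by rw [smul_smul, hb.eq]; rfl)

theorem cutFunctor_preservesHomology {b : B} (hb : IsIdempotentElem b) :
    (cutFunctor k b).PreservesHomology :=
  ((cutFunctor k b).exact_tfae.out 1 2).1 (cutFunctor_exact hb)

theorem cutFunctor_shortExact {b : B} (hb : IsIdempotentElem b) {S : ShortComplex (ModuleCat.{u} B)}
    (hS : S.ShortExact) : (S.map (cutFunctor k b)).ShortExact :=
  (((cutFunctor k b).exact_tfae.out 1 0 :) : _ ↔ ∀ S : ShortComplex (ModuleCat.{u} B),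
    S.ShortExact → (S.map (cutFunctor k b)).ShortExact).1 (cutFunctor_exact hb) S hS

theorem finiteDimensional_moduleCat [FiniteDimensional k B] (X : ModuleCat.{u} B)
    [Module.Finite B X] : FiniteDimensional k X :=
  Module.Finite.trans B X

theorem finiteDimensional_cutFunctor_obj (b : B) (X : ModuleCat.{u} B) [FiniteDimensional k X] :
    FiniteDimensional k ((cutFunctor k b).obj X) :=
  inferInstanceAs (FiniteDimensional k (LinearMap.range (Algebra.lsmul k k X b)))

theorem linearRank_cutFunctor_map (b : B)
    {X Y : ModuleCat.{u} B} (f : X ⟶ Y) :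
    linearRank ((cutFunctor k b).map f).hom
      = linearRank (Algebra.lsmul k k Y b ∘ₗ f.hom.restrictScalars k) := by
  let incl : (cutFunctor k b).obj Y →ₗ[k] Y := (LinearMap.range (Algebra.lsmul k k Y b)).subtype
  let proj : X →ₗ[k] (cutFunctor k b).obj X := (Algebra.lsmul k k X b).rangeRestrict
  have hproj : Function.Surjective proj := (Algebra.lsmul k k X b).surjective_rangeRestrict
  rw [← linearRank_comp_of_injective (g := incl) Subtype.val_injective,
    ← linearRank_comp_of_surjective _ hproj]
  exact congrArg linearRank (LinearMap.ext fun x => map_smul f.hom b x)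

/-- The free left module of rank one is `B` as a vector space. -/
def freeModuleEquiv (k B : Type u) [Field k] [Ring B] [Algebra k B] : freeModule B ≃ₗ[k] B :=
  { AddEquiv.refl B with
    map_smul' := fun c x => (Algebra.smul_def (A := B) c x).symm }

theorem linearRank_cutFunctor_map_rightMul (b c : B) :
    linearRank ((cutFunctor k b).map (rightMul c)).hom
      = linearRank (LinearMap.mulLeftRight k (b, c)) := by
  rw [linearRank_cutFunctor_map]
  refine linearRank_eq_of_comp_eq_comp (freeModuleEquiv k B) (freeModuleEquiv k B)
    (LinearMap.ext fun x => ?_)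
  exact (LinearMap.mulLeftRight_apply b c _).trans (mul_assoc b _ c)

end Cut

/-! ### Invertibility of the Cartan matrix -/

section CartanInvertible

open scoped ModuleCat

variable {k B : Type u} [Field k] [Ring B] [Algebra k B] {ι : Type*}

/-- The dimension vector `(dim (ε i) X)ᵢ` of a left module `X`. -/
def dimVec (k : Type u) [Field k] [Algebra k B] (ε : ι → B) (X : ModuleCat.{u} B) (i : ι) : ℤ :=
  Module.finrank k ((cutFunctor k (ε i)).obj X)

/-- The matrix `(dim (ε i) B (ε j))`, whose columns are the dimension vectors of the projective left
modules `B (ε j)`. -/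
def idempotentCartanMatrix (k : Type u) [Field k] [Algebra k B] (ε : ι → B) : Matrix ι ι ℤ :=
  Matrix.of fun i j => (linearRank (LinearMap.mulLeftRight k (ε i, ε j)) : ℤ)

variable [FiniteDimensional k B]

theorem dimVec_of_shortExact {ε : ι → B} (hε : ∀ i, IsIdempotentElem (ε i))
    {S : ShortComplex (ModuleCat.{u} B)} (hS : S.ShortExact) [Module.Finite B S.X₁]
    [Module.Finite B S.X₃] : dimVec k ε S.X₂ = dimVec k ε S.X₁ + dimVec k ε S.X₃ := by
  ext i
  have := finiteDimensional_moduleCat (k := k) S.X₁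
  have := finiteDimensional_moduleCat (k := k) S.X₃
  have : FiniteDimensional k (S.map (cutFunctor k (ε i))).X₁ :=
    finiteDimensional_cutFunctor_obj _ S.X₁
  have : FiniteDimensional k (S.map (cutFunctor k (ε i))).X₃ :=
    finiteDimensional_cutFunctor_obj _ S.X₃
  exact (congrArg Nat.cast (ModuleCat.free_shortExact_finrank_add
    (cutFunctor_shortExact (k := k) (hε i) hS) rfl rfl)).trans (Nat.cast_add _ _)

variable [Fintype ι] [DecidableEq ι] {ε : ι → B} {π : B →ₐ[k] (ι → k)}

namespace IsSplitBasic

theorem exists_dimVec_eq_mulVec_of_projective (h : IsSplitBasic ε π) (X : ModuleCat.{u} B)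
    [Module.Finite B X] [Module.Projective B X] :
    ∃ z : ι → ℤ, dimVec k ε X = (idempotentCartanMatrix k ε).mulVec z := by
  obtain ⟨N, hN⟩ := h.exists_isMultiplicity X
  refine ⟨fun a => N a, funext fun i => ?_⟩
  have := finiteDimensional_moduleCat (k := k) X
  have := finiteDimensional_cutFunctor_obj (k := k) (ε i) X
  rw [dimVec, hN, Matrix.mulVec, dotProduct, Nat.cast_sum]
  refine Finset.sum_congr rfl fun a _ => ?_
  rw [Nat.cast_mul, mul_comm, linearRank_cutFunctor_map_rightMul]
  rfl

theorem exists_dimVec_eq_mulVec (h : IsSplitBasic ε π) (d : ℕ) (X : ModuleCat.{u} B)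
    [Module.Finite B X] [hd : HasProjectiveDimensionLE X d] :
    ∃ z : ι → ℤ, dimVec k ε X = (idempotentCartanMatrix k ε).mulVec z := by
  have : IsNoetherianRing B := IsNoetherianRing.of_finite k B
  induction d generalizing X with
  | zero =>
    have : Projective X := projective_iff_hasProjectiveDimensionLT_one.2 hd
    have : Module.Projective B X := (IsProjective.iff_projective X).2 this
    exact h.exists_dimVec_eq_mulVec_of_projective X
  | succ d ih =>
    obtain ⟨n, f, hf⟩ := Module.Finite.exists_fin' B X
    have hS := LinearMap.shortExact_shortComplexKer hf
    have hproj : Projective f.shortComplexKer.X₂ :=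
      (IsProjective.iff_projective (Fin n → B)).1 inferInstance
    have := (hS.hasProjectiveDimensionLT_X₃_iff d hproj).1 hd
    obtain ⟨z₁, hz₁⟩ := ih (ModuleCat.of B (LinearMap.ker f))
    obtain ⟨z₂, hz₂⟩ := h.exists_dimVec_eq_mulVec_of_projective (ModuleCat.of B (Fin n → B))
    refine ⟨z₂ - z₁, ?_⟩
    have := dimVec_of_shortExact (k := k) h.complete.idem hS
    rw [Matrix.mulVec_sub, ← hz₁, ← hz₂]
    exact eq_sub_of_add_eq' this.symm

end IsSplitBasic

/-- The one-dimensional left module on which `B` acts through the component `a` of `π`. -/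
def simpleModule (π : B →ₐ[k] (ι → k)) (a : ι) : ModuleCat.{u} B :=
  (ModuleCat.restrictScalars ((Pi.evalRingHom (fun _ => k) a).comp (π : B →+* (ι → k)))).obj
    (ModuleCat.of k k)

/-- The underlying vector space of `simpleModule π a`. -/
def simpleModuleEquiv (π : B →ₐ[k] (ι → k)) (a : ι) : simpleModule π a ≃ₗ[k] k :=
  { AddEquiv.refl k with
    map_smul' := fun c x => by
      change π (algebraMap k B c) a * (show k from x) = c * (show k from x)
      rw [AlgHom.commutes]
      rfl }

namespace IsSplitBasic

omit [FiniteDimensional k B] in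
theorem dimVec_simpleModule (h : IsSplitBasic ε π) (a : ι) :
    dimVec k ε (simpleModule π a) = Pi.single a 1 := by
  ext i
  change (linearRank (Algebra.lsmul k k (simpleModule π a) (ε i)) : ℤ) = _
  rw [linearRank_eq_of_comp_eq_comp (simpleModuleEquiv π a) (simpleModuleEquiv π a)
    (f' := π (ε i) a • LinearMap.id) (LinearMap.ext fun _ => rfl), h.map_single]
  rcases eq_or_ne i a with rfl | hi
  · rw [Pi.single_eq_same, one_smul, linearRank_id, Module.finrank_self, Pi.single_eq_same,
      Nat.cast_one]
  · rw [Pi.single_eq_of_ne hi.symm, zero_smul, Pi.single_eq_of_ne hi, linearRank,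
      LinearMap.range_zero, finrank_bot, Nat.cast_zero]

theorem isUnit_det_idempotentCartanMatrix (h : IsSplitBasic ε π) {d : ℕ}
    (hd : ∀ X : ModuleCat.{u} B, HasProjectiveDimensionLE X d) :
    IsUnit (idempotentCartanMatrix k ε).det := by
  have hcol : ∀ a, ∃ z : ι → ℤ, Pi.single a 1 = (idempotentCartanMatrix k ε).mulVec z := by
    intro a
    have : Module.Finite k (simpleModule π a) := Module.Finite.equiv (simpleModuleEquiv π a).symm
    have : Module.Finite B (simpleModule π a) := Module.Finite.of_restrictScalars_finite k _ _
    have := hd (simpleModule π a)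
    rw [← h.dimVec_simpleModule a]
    exact h.exists_dimVec_eq_mulVec d _
  choose z hz using hcol
  refine Matrix.isUnit_det_of_right_inverse (B := (Matrix.of z).transpose) ?_
  ext i a
  rw [Matrix.one_apply, ← Pi.single_apply a (1 : ℤ) i, hz a]
  rfl

end IsSplitBasic

end CartanInvertible

section CartanAlgebra

open scoped ModuleCat

variable {k A : Type u} [Field k] [Ring A] [Algebra k A] {r : ℕ}

/-- `A` is the vector space underlying the regular bimodule. -/
def regularBimoduleEquiv (k A : Type u) [Field k] [Ring A] [Algebra k A] :
    regularBimodule k A ≃ₗ[k] A :=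
  { AddEquiv.refl A with
    map_smul' := fun c x => by
      let : Module (Env k A) A := TensorProduct.Algebra.module
      change (algebraMap k (Env k A) c) • (show A from x) = c • (show A from x)
      rw [Algebra.TensorProduct.algebraMap_apply, TensorProduct.Algebra.smul_def, one_smul,
        algebraMap_smul] }

theorem regularBimoduleEquiv_smul (a : A) (b : Aᵐᵒᵖ) (x : regularBimodule k A) :
    regularBimoduleEquiv k A ((a ⊗ₜ[k] b : Env k A) • x)
      = a * regularBimoduleEquiv k A x * b.unop := by
  let : Module (Env k A) A := TensorProduct.Algebra.module
  change (a ⊗ₜ[k] b : Env k A) • (show A from x) = _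
  rw [TensorProduct.Algebra.smul_def, mul_assoc]
  rfl

theorem cartanMatrixAlgebra_apply (e : Fin r → A) (i j : Fin r) :
    cartanMatrixAlgebra k e i j = linearRank (LinearMap.mulLeftRight k (e j, e i)) := by
  refine congrArg Nat.cast (linearRank_eq_of_comp_eq_comp (regularBimoduleEquiv k A)
    (regularBimoduleEquiv k A) (LinearMap.ext fun x => ?_))
  exact (LinearMap.mulLeftRight_apply _ _ _).trans (regularBimoduleEquiv_smul _ _ x).symm

theorem cartanMatrixAlgebra_eq_idempotentCartanMatrix_op (e : Fin r → A) :
    cartanMatrixAlgebra k e = idempotentCartanMatrix k fun i => MulOpposite.op (e i) := by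
  ext i j
  rw [cartanMatrixAlgebra_apply]
  refine congrArg Nat.cast (linearRank_eq_of_comp_eq_comp (MulOpposite.opLinearEquiv k)
    (MulOpposite.opLinearEquiv k) (LinearMap.ext fun x => ?_))
  simp [mul_assoc]

theorem IsSplitBasic.isUnit_det_cartanMatrixAlgebra [FiniteDimensional k A] {e : Fin r → A}
    {π : A →ₐ[k] (Fin r → k)} (h : IsSplitBasic e π) (hgl : FiniteGlobalDimension A) :
    IsUnit (cartanMatrixAlgebra k e).det := by
  obtain ⟨d, hd⟩ := hgl
  rw [cartanMatrixAlgebra_eq_idempotentCartanMatrix_op]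
  exact h.op.isUnit_det_idempotentCartanMatrix hd

end CartanAlgebra

/-! ### Tensor products with the free bimodule -/

section TensorFree

open scoped ModuleCat

variable {k A : Type u} [Field k] [Ring A] [Algebra k A]

/-- The bimodule `K ⊗_A N`. -/
abbrev tensorObj (K N : Bimod k A) : Bimod k A := ((tensorBifunctor k A).obj K).obj N

/-- The quotient map `K ⊗ₖ N → K ⊗_A N`. -/
def tensorQuot (K N : Bimod k A) : K ⊗[k] N →ₗ[k] tensorObj K N where
  toFun := (balancing k A K N).mkQ
  map_add' := map_add (balancing k A K N).mkQ
  map_smul' c z := by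
    refine congrArg (balancing k A K N).mkQ (Eq.symm ?_)
    change outerAction k A K N (algebraMap k (Env k A) c) z = c • z
    rw [AlgHom.commutes, Module.algebraMap_end_apply]

variable {K N : Bimod k A}

theorem tensorQuot_surjective : Function.Surjective (tensorQuot K N) := by
  intro x
  obtain ⟨z, hz⟩ := Submodule.Quotient.mk_surjective (balancing k A K N) x
  exact ⟨z, hz⟩

theorem tensorQuot_smul_tmul (m : K) (a : A) (n : N) :
    tensorQuot K N ((((1 : A) ⊗ₜ[k] MulOpposite.op a : Env k A) • m) ⊗ₜ n)
      = tensorQuot K N (m ⊗ₜ ((a ⊗ₜ[k] (1 : Aᵐᵒᵖ) : Env k A) • n)) :=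
  (Submodule.Quotient.eq (balancing k A K N)).2 (Submodule.subset_span ⟨m, a, n, rfl⟩)

theorem smul_outerMk (a : A) (b : Aᵐᵒᵖ) (m : K) (n : N) :
    (a ⊗ₜ[k] b : Env k A) • outerMk k A K N m n
      = outerMk k A K N ((a ⊗ₜ[k] (1 : Aᵐᵒᵖ) : Env k A) • m)
        (((1 : A) ⊗ₜ[k] b : Env k A) • n) :=
  outerAction_tmul k A K N a b m n

theorem smul_tensorMk (a : A) (b : Aᵐᵒᵖ) (m : K) (n : N) :
    (a ⊗ₜ[k] b : Env k A) • tensorMk k A m n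
      = tensorMk k A ((a ⊗ₜ[k] (1 : Aᵐᵒᵖ) : Env k A) • m) (((1 : A) ⊗ₜ[k] b : Env k A) • n) :=
  congrArg Submodule.Quotient.mk (smul_outerMk a b m n)

theorem smul_tensorQuot_tmul (a : A) (b : Aᵐᵒᵖ) (m : K) (n : N) :
    (a ⊗ₜ[k] b : Env k A) • tensorQuot K N (m ⊗ₜ[k] n)
      = tensorQuot K N
        (((a ⊗ₜ[k] (1 : Aᵐᵒᵖ) : Env k A) • m) ⊗ₜ[k] (((1 : A) ⊗ₜ[k] b : Env k A) • n)) :=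
  smul_tensorMk a b m n

theorem ker_tensorQuot_le {V : Type*} [AddCommGroup V] [Module k V] {φ : K ⊗[k] N →ₗ[k] V}
    (hφ : ∀ m a n, φ ((((1 : A) ⊗ₜ[k] MulOpposite.op a : Env k A) • m) ⊗ₜ n)
      = φ (m ⊗ₜ ((a ⊗ₜ[k] (1 : Aᵐᵒᵖ) : Env k A) • n))) :
    LinearMap.ker (tensorQuot K N) ≤ LinearMap.ker φ := by
  let φ' : OuterTensor k A K N →+ V := AddMonoidHom.mk' φ (map_add φ)
  let S : Submodule (Env k A) (OuterTensor k A K N) :=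
    { carrier := {z | ∀ s : Env k A, φ' (s • z) = 0}
      zero_mem' := fun s => by rw [smul_zero, map_zero]
      add_mem' := fun {x y} hx hy s => by rw [smul_add, map_add, hx, hy, add_zero]
      smul_mem' := fun t z hz s => by rw [smul_smul, hz] }
  have hS : balancing k A K N ≤ S := by
    refine Submodule.span_le.2 ?_
    rintro _ ⟨m, a, n, rfl⟩ s
    induction s using TensorProduct.induction_on with
    | zero => exact (congrArg φ' (zero_smul (Env k A) _)).trans (map_zero φ')
    | add s t hs ht => rw [add_smul, map_add, hs, ht, add_zero]
    | tmul b c =>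
      rw [smul_sub, map_sub, smul_outerMk, smul_outerMk, sub_eq_zero, smul_smul, smul_smul,
        Algebra.TensorProduct.tmul_mul_tmul, Algebra.TensorProduct.tmul_mul_tmul]
      have h := hφ ((b ⊗ₜ[k] (1 : Aᵐᵒᵖ) : Env k A) • m) a (((1 : A) ⊗ₜ[k] c : Env k A) • n)
      rw [smul_smul, smul_smul, Algebra.TensorProduct.tmul_mul_tmul,
        Algebra.TensorProduct.tmul_mul_tmul] at h
      simp only [one_mul, mul_one] at h ⊢
      exact h
  intro z hz
  have h := hS ((Submodule.Quotient.mk_eq_zero _).1 hz) 1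
  exact (congrArg φ' (one_smul (Env k A) _)).symm.trans h

/-- The linear map `K ⊗ₖ Aᵉ → K ⊗ₖ A`, `m ⊗ (a ⊗ bᵒᵖ) ↦ m a ⊗ b`. -/
def freeContract (K : Bimod k A) : K ⊗[k] freeModule (Env k A) →ₗ[k] K ⊗[k] A :=
  TensorProduct.map
      (TensorProduct.lift ((Algebra.lsmul k k K).toLinearMap ∘ₗ
        (Algebra.TensorProduct.includeRight : Aᵐᵒᵖ →ₐ[k] Env k A).toLinearMap ∘ₗ
        (MulOpposite.opLinearEquiv k).toLinearMap).flip)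
      (MulOpposite.opLinearEquiv k).symm.toLinearMap ∘ₗ
    (TensorProduct.assoc k K A Aᵐᵒᵖ).symm.toLinearMap ∘ₗ
    LinearMap.lTensor K (freeModuleEquiv k (Env k A)).toLinearMap

/-- The element `a ⊗ bᵒᵖ` of the free bimodule of rank one. -/
def freeMk (k : Type u) [Field k] [Algebra k A] (a b : A) : freeModule (Env k A) :=
  (a ⊗ₜ[k] MulOpposite.op b : Env k A)

theorem smul_freeMk (a b c d : A) :
    (a ⊗ₜ[k] MulOpposite.op b : Env k A) • freeMk k c d = freeMk k (a * c) (d * b) :=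
  Algebra.TensorProduct.tmul_mul_tmul _ _ _ _

theorem rightMul_freeMk (a b c d : A) :
    (rightMul (c ⊗ₜ[k] MulOpposite.op d : Env k A)).hom (freeMk k a b)
      = freeMk k (a * c) (d * b) :=
  Algebra.TensorProduct.tmul_mul_tmul _ _ _ _

theorem freeModule_induction {p : freeModule (Env k A) → Prop} (z : freeModule (Env k A))
    (zero : p 0) (add : ∀ x y, p x → p y → p (x + y)) (mk : ∀ a b, p (freeMk k a b)) : p z :=
  TensorProduct.induction_on (motive := p) z zero (fun a b => mk a b.unop) add

theorem freeContract_tmul (m : K) (a b : A) :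
    freeContract K (m ⊗ₜ[k] freeMk k a b)
      = (((1 : A) ⊗ₜ[k] MulOpposite.op a : Env k A) • m) ⊗ₜ[k] b :=
  rfl

theorem freeContract_smul_tmul (m : K) (a : A) (z : freeModule (Env k A)) :
    freeContract K ((((1 : A) ⊗ₜ[k] MulOpposite.op a : Env k A) • m) ⊗ₜ z)
      = freeContract K (m ⊗ₜ ((a ⊗ₜ[k] (1 : Aᵐᵒᵖ) : Env k A) • z)) := by
  induction z using freeModule_induction with
  | zero => rw [smul_zero, TensorProduct.tmul_zero, TensorProduct.tmul_zero]
  | add x y hx hy =>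
    rw [smul_add, TensorProduct.tmul_add, TensorProduct.tmul_add, map_add, map_add, hx, hy]
  | mk c d =>
    rw [← MulOpposite.op_one, smul_freeMk, mul_one, freeContract_tmul, freeContract_tmul,
      smul_smul, Algebra.TensorProduct.tmul_mul_tmul, mul_one, MulOpposite.op_mul]

/-- The linear map `K ⊗ₖ A → K ⊗ₖ Aᵉ`, `m ⊗ x ↦ m ⊗ (1 ⊗ xᵒᵖ)`. -/
def freeInsert (K : Bimod k A) : K ⊗[k] A →ₗ[k] K ⊗[k] freeModule (Env k A) :=
  LinearMap.lTensor K ((freeModuleEquiv k (Env k A)).symm.toLinearMap ∘ₗ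
    TensorProduct.mk k A Aᵐᵒᵖ 1 ∘ₗ (MulOpposite.opLinearEquiv k).toLinearMap)

theorem freeContract_comp_freeInsert : freeContract K ∘ₗ freeInsert K = LinearMap.id := by
  refine TensorProduct.ext' fun m x => (freeContract_tmul m 1 x).trans ?_
  rw [MulOpposite.op_one, ← Algebra.TensorProduct.one_def, one_smul, LinearMap.id_apply]

/-- The linear map `K ⊗ₖ A → K ⊗_A Aᵉ`, `m ⊗ x ↦ m ⊗ (1 ⊗ xᵒᵖ)`. -/
def tensorFreeMap (K : Bimod k A) : K ⊗[k] A →ₗ[k] tensorObj K (freeModule (Env k A)) :=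
  tensorQuot K _ ∘ₗ freeInsert K

theorem tensorFreeMap_tmul (m : K) (x : A) :
    tensorFreeMap K (m ⊗ₜ[k] x) = tensorQuot K _ (m ⊗ₜ[k] freeMk k 1 x) :=
  rfl

theorem tensorQuot_tmul_freeMk (m : K) (a b : A) :
    tensorQuot K _ (m ⊗ₜ[k] freeMk k a b)
      = tensorFreeMap K ((((1 : A) ⊗ₜ[k] MulOpposite.op a : Env k A) • m) ⊗ₜ[k] b) := by
  rw [tensorFreeMap_tmul, tensorQuot_smul_tmul, ← MulOpposite.op_one, smul_freeMk, mul_one, mul_one]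

theorem tensorFreeMap_injective : Function.Injective (tensorFreeMap K) := by
  refine (injective_iff_map_eq_zero _).2 fun t ht => ?_
  rw [← LinearMap.id_apply (R := k) t, ← freeContract_comp_freeInsert]
  exact ker_tensorQuot_le freeContract_smul_tmul ht

theorem tensorFreeMap_surjective : Function.Surjective (tensorFreeMap K) := by
  rw [← LinearMap.range_eq_top, Submodule.eq_top_iff']
  refine tensorQuot_surjective.forall.2 fun t => ?_
  induction t using TensorProduct.induction_on with
  | zero => exact map_zero (tensorQuot K _) ▸ zero_mem _
  | add x y hx hy => exact map_add (tensorQuot K _) x y ▸ add_mem hx hy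
  | tmul m z =>
    induction z using freeModule_induction with
    | zero => rw [TensorProduct.tmul_zero, map_zero]; exact zero_mem _
    | add x y hx hy => rw [TensorProduct.tmul_add, map_add]; exact add_mem hx hy
    | mk a b => rw [tensorQuot_tmul_freeMk]; exact LinearMap.mem_range_self _ _

variable (K) in
/-- `K ⊗_A Aᵉ` is `K ⊗ₖ A` as a vector space. -/
def tensorFreeEquiv : K ⊗[k] A ≃ₗ[k] tensorObj K (freeModule (Env k A)) :=
  LinearEquiv.ofBijective (tensorFreeMap K) ⟨tensorFreeMap_injective, tensorFreeMap_surjective⟩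

theorem tensorFreeEquiv_tmul (m : K) (x : A) :
    tensorFreeEquiv K (m ⊗ₜ[k] x) = tensorQuot K _ (m ⊗ₜ[k] freeMk k 1 x) :=
  rfl

theorem smul_tensorFreeEquiv_tmul (a b : A) (m : K) (x : A) :
    (a ⊗ₜ[k] MulOpposite.op b : Env k A) • tensorFreeEquiv K (m ⊗ₜ[k] x)
      = tensorFreeEquiv K (((a ⊗ₜ[k] (1 : Aᵐᵒᵖ) : Env k A) • m) ⊗ₜ[k] (x * b)) := by
  rw [tensorFreeEquiv_tmul, smul_tensorQuot_tmul, smul_freeMk, one_mul, tensorFreeEquiv_tmul]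

theorem tensorBifunctor_map_rightMul_tensorFreeEquiv (c d : A) (m : K) (x : A) :
    (((tensorBifunctor k A).obj K).map (rightMul (c ⊗ₜ[k] MulOpposite.op d))).hom
        (tensorFreeEquiv K (m ⊗ₜ[k] x))
      = tensorFreeEquiv K
        ((((1 : A) ⊗ₜ[k] MulOpposite.op c : Env k A) • m) ⊗ₜ[k] (d * x)) := by
  refine Eq.trans ?_ (tensorQuot_tmul_freeMk m c (d * x))
  rw [← one_mul c, ← rightMul_freeMk, one_mul]
  rfl

theorem linearRank_cutFunctor_tensor_map_rightMul (a b c d : A) :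
    linearRank (((tensorBifunctor k A).obj K ⋙ cutFunctor k (a ⊗ₜ[k] MulOpposite.op b)).map
        (rightMul (c ⊗ₜ[k] MulOpposite.op d))).hom
      = linearRank (Algebra.lsmul k k K (a ⊗ₜ[k] MulOpposite.op c : Env k A))
        * linearRank (LinearMap.mulLeftRight k (d, b)) := by
  refine (linearRank_cutFunctor_map _ (((tensorBifunctor k A).obj K).map _)).trans ?_
  rw [← linearRank_tensorMap]
  refine (linearRank_eq_of_comp_eq_comp (tensorFreeEquiv K) (tensorFreeEquiv K)
    (TensorProduct.ext' fun m x => ?_)).symm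
  refine (congrArg ((a ⊗ₜ[k] MulOpposite.op b : Env k A) • ·)
    (tensorBifunctor_map_rightMul_tensorFreeEquiv c d m x)).trans ?_
  refine (smul_tensorFreeEquiv_tmul ..).trans (congrArg (tensorFreeEquiv K) ?_)
  rw [smul_smul, Algebra.TensorProduct.tmul_mul_tmul, mul_one, one_mul]
  rfl

theorem envTensor_mk_tmul_smul {X : Bimod k A} (b a a' : A) (x : X) :
    (Submodule.Quotient.mk (b ⊗ₜ[k] ((a ⊗ₜ[k] MulOpposite.op a' : Env k A) • x)) : EnvTensor k A X)
      = Submodule.Quotient.mk ((a' * b * a) ⊗ₜ[k] x) :=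
  ((Submodule.Quotient.eq (envBalancing k A X)).2 (Submodule.subset_span ⟨b, a, a', x, rfl⟩)).symm

/-- The linear map `A ⊗ₖ (K ⊗ₖ A) → K`, `b ⊗ (m ⊗ x) ↦ x b m`. -/
def cyclicContract (K : Bimod k A) : A ⊗[k] (K ⊗[k] A) →ₗ[k] K :=
  TensorProduct.lift ((Algebra.lsmul k k K).toLinearMap ∘ₗ
      (Algebra.TensorProduct.includeLeft : A →ₐ[k] Env k A).toLinearMap) ∘ₗ
    LinearMap.rTensor K (LinearMap.mul' k A) ∘ₗ
    (TensorProduct.assoc k A A K).symm.toLinearMap ∘ₗ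
    (TensorProduct.comm k (A ⊗[k] K) A).toLinearMap ∘ₗ
    (TensorProduct.assoc k A K A).symm.toLinearMap

theorem cyclicContract_tmul (b : A) (m : K) (x : A) :
    cyclicContract K (b ⊗ₜ[k] (m ⊗ₜ[k] x)) = ((x * b) ⊗ₜ[k] (1 : Aᵐᵒᵖ) : Env k A) • m :=
  rfl

theorem cyclicContract_tensorFreeEquiv_symm_smul (b a a' : A)
    (v : tensorObj K (freeModule (Env k A))) :
    cyclicContract K ((a' * b * a) ⊗ₜ[k] (tensorFreeEquiv K).symm v)
      = cyclicContract K (b ⊗ₜ[k] (tensorFreeEquiv K).symm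
        ((a ⊗ₜ[k] MulOpposite.op a' : Env k A) • v)) := by
  obtain ⟨t, rfl⟩ := (tensorFreeEquiv K).surjective v
  induction t using TensorProduct.induction_on with
  | zero => simp only [map_zero, smul_zero, TensorProduct.tmul_zero]
  | add x y hx hy => simp only [map_add, smul_add, TensorProduct.tmul_add, hx, hy]
  | tmul m x =>
    rw [smul_tensorFreeEquiv_tmul, LinearEquiv.symm_apply_apply, LinearEquiv.symm_apply_apply,
      cyclicContract_tmul, cyclicContract_tmul, smul_smul, Algebra.TensorProduct.tmul_mul_tmul,
      mul_one, mul_assoc, mul_assoc, mul_assoc]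

/-- The linear map `K → A ⊗_{Aᵉ} (K ⊗_A Aᵉ)`, `m ↦ 1 ⊗ (m ⊗ 1)`. -/
def envTensorFreeMap (K : Bimod k A) :
    K →ₗ[k] EnvTensor k A (tensorObj K (freeModule (Env k A))) :=
  (envBalancing k A _).mkQ ∘ₗ TensorProduct.mk k A _ 1 ∘ₗ (tensorFreeEquiv K).toLinearMap ∘ₗ
    (TensorProduct.mk k K A).flip 1

theorem envTensorFreeMap_apply (m : K) :
    envTensorFreeMap K m = Submodule.Quotient.mk (1 ⊗ₜ[k] tensorFreeEquiv K (m ⊗ₜ[k] 1)) :=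
  rfl

theorem envTensor_mk_tmul_tensorFreeEquiv (b : A) (m : K) (x : A) :
    (Submodule.Quotient.mk (b ⊗ₜ[k] tensorFreeEquiv K (m ⊗ₜ[k] x)) :
        EnvTensor k A (tensorObj K (freeModule (Env k A))))
      = envTensorFreeMap K (((x * b) ⊗ₜ[k] (1 : Aᵐᵒᵖ) : Env k A) • m) := by
  have hright := smul_tensorFreeEquiv_tmul (k := k) 1 x m 1
  have hleft := smul_tensorFreeEquiv_tmul (k := k) (x * b) 1 m 1
  rw [← Algebra.TensorProduct.one_def, one_smul, one_mul] at hright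
  rw [one_mul] at hleft
  rw [envTensorFreeMap_apply, ← hleft, ← hright, envTensor_mk_tmul_smul, envTensor_mk_tmul_smul,
    mul_one, one_mul, one_mul]

theorem envTensorFreeMap_injective : Function.Injective (envTensorFreeMap K) := by
  let contract : EnvTensor k A (tensorObj K (freeModule (Env k A))) →ₗ[k] K :=
    Submodule.liftQ _ (cyclicContract K ∘ₗ LinearMap.lTensor A (tensorFreeEquiv K).symm.toLinearMap)
      (Submodule.span_le.2 (by
        rintro _ ⟨b, a, a', v, rfl⟩
        rw [SetLike.mem_coe, LinearMap.mem_ker, map_sub, sub_eq_zero]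
        exact cyclicContract_tensorFreeEquiv_symm_smul b a a' v))
  refine Function.LeftInverse.injective (g := contract) fun m => ?_
  change cyclicContract K (1 ⊗ₜ[k] (tensorFreeEquiv K).symm (tensorFreeEquiv K (m ⊗ₜ[k] 1))) = m
  rw [LinearEquiv.symm_apply_apply, cyclicContract_tmul, one_mul, ← Algebra.TensorProduct.one_def,
    one_smul]

theorem envTensorFreeMap_surjective : Function.Surjective (envTensorFreeMap K) := by
  rw [← LinearMap.range_eq_top, Submodule.eq_top_iff']
  refine (Submodule.Quotient.mk_surjective _).forall.2 fun u => ?_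
  induction u using TensorProduct.induction_on with
  | zero => exact zero_mem _
  | add x y hx hy => exact add_mem hx hy
  | tmul b v =>
    obtain ⟨t, rfl⟩ := (tensorFreeEquiv K).surjective v
    induction t using TensorProduct.induction_on with
    | zero => rw [map_zero, TensorProduct.tmul_zero]; exact zero_mem _
    | add x y hx hy => rw [map_add, TensorProduct.tmul_add]; exact add_mem hx hy
    | tmul m x => exact ⟨_, (envTensor_mk_tmul_tensorFreeEquiv b m x).symm⟩

variable (K) in
/-- `A ⊗_{Aᵉ} (K ⊗_A Aᵉ)` is `K` as a vector space. -/
def envTensorFreeEquiv : K ≃ₗ[k] EnvTensor k A (tensorObj K (freeModule (Env k A))) :=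
  LinearEquiv.ofBijective (envTensorFreeMap K)
    ⟨envTensorFreeMap_injective, envTensorFreeMap_surjective⟩

theorem linearRank_envTensor_tensor_map_rightMul (c d : A) :
    linearRank (((tensorBifunctor k A).obj K ⋙ envTensorFunctor k A).map
        (rightMul (c ⊗ₜ[k] MulOpposite.op d))).hom
      = linearRank (Algebra.lsmul k k K (d ⊗ₜ[k] MulOpposite.op c : Env k A)) := by
  refine (linearRank_eq_of_comp_eq_comp (envTensorFreeEquiv K) (envTensorFreeEquiv K)
    (LinearMap.ext fun m => ?_)).symm
  refine (congrArg (fun v : tensorObj K (freeModule (Env k A)) =>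
    (Submodule.Quotient.mk ((1 : A) ⊗ₜ[k] v) : EnvTensor k A _))
    (tensorBifunctor_map_rightMul_tensorFreeEquiv c d m 1)).trans ?_
  refine (envTensor_mk_tmul_tensorFreeEquiv ..).trans (congrArg (envTensorFreeMap K) ?_)
  rw [smul_smul, Algebra.TensorProduct.tmul_mul_tmul, one_mul, mul_one, mul_one, mul_one]
  rfl

theorem finiteDimensional_tensorObj [FiniteDimensional k K] [FiniteDimensional k N] :
    FiniteDimensional k (tensorObj K N) :=
  Module.Finite.of_surjective (tensorQuot K N) tensorQuot_surjective

end TensorFree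

/-! ### Cartan matrices of tensor products with projectives -/

section CartanTensor

open scoped ModuleCat

variable {k A : Type u} [Field k] [Ring A] [Algebra k A]

theorem linearRank_mulLeftRight_env (a b c d : A) :
    linearRank (LinearMap.mulLeftRight k
        ((a ⊗ₜ[k] MulOpposite.op b : Env k A), (c ⊗ₜ[k] MulOpposite.op d : Env k A)))
      = linearRank (LinearMap.mulLeftRight k (a, c))
        * linearRank (LinearMap.mulLeftRight k (d, b)) := by
  have htensor : LinearMap.mulLeftRight k
      ((a ⊗ₜ[k] MulOpposite.op b : Env k A), (c ⊗ₜ[k] MulOpposite.op d : Env k A))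
      = TensorProduct.map (LinearMap.mulLeftRight k (a, c))
        (LinearMap.mulLeftRight k (MulOpposite.op b, MulOpposite.op d)) :=
    TensorProduct.ext' fun x y => by
      simp only [LinearMap.mulLeftRight_apply, Algebra.TensorProduct.tmul_mul_tmul,
        TensorProduct.map_tmul]
  have hop : linearRank (LinearMap.mulLeftRight k (MulOpposite.op b, MulOpposite.op d))
      = linearRank (LinearMap.mulLeftRight k (d, b)) :=
    linearRank_eq_of_comp_eq_comp (MulOpposite.opLinearEquiv k).symm
      (MulOpposite.opLinearEquiv k).symm (LinearMap.ext fun x => by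
        simp [LinearMap.mulLeftRight_apply, mul_assoc])
  rw [htensor, linearRank_tensorMap, hop]

theorem finiteDimensional_envTensor [FiniteDimensional k A] (X : Bimod k A)
    [FiniteDimensional k X] : FiniteDimensional k ((envTensorFunctor k A).obj X) :=
  Module.Finite.of_surjective _ (envBalancing k A X).mkQ_surjective

variable {r : ℕ} {e : Fin r → A}

theorem cartanMatrix_apply (e : Fin r → A) (X : Bimod k A) (i j : Fin r) :
    cartanMatrix e X i j = Module.finrank k ((cutFunctor k (envIdempotent k e (j, i))).obj X) :=
  rfl

/-- The multiplicities of the projective bimodules `A (e c) ⊗ (e d) A`, arranged as a matrix with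
rows indexed by `d` and columns indexed by `c`. -/
def multiplicityMatrix (N : Fin r × Fin r → ℕ) : Matrix (Fin r) (Fin r) ℤ :=
  Matrix.of fun d c => (N (c, d) : ℤ)

variable [FiniteDimensional k A] {Q : Bimod k A}

namespace IsMultiplicity

variable [Module.Finite (Env k A) Q] {N : Fin r × Fin r → ℕ}
  (hN : IsMultiplicity k (envIdempotent k e) Q N)
include hN

theorem cartanMatrix_eq :
    cartanMatrix e Q
      = cartanMatrixAlgebra k e * multiplicityMatrix N * cartanMatrixAlgebra k e := by
  ext i j
  have := finiteDimensional_moduleCat (k := k) Q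
  have := finiteDimensional_cutFunctor_obj (k := k) (envIdempotent k e (j, i)) Q
  refine (congrArg (Nat.cast : ℕ → ℤ) ((hN (cutFunctor k (envIdempotent k e (j, i)))).trans
    (Finset.sum_congr rfl fun p _ => congrArg (N p * ·)
      ((linearRank_cutFunctor_map_rightMul _ _).trans
        (linearRank_mulLeftRight_env (e j) (e i) (e p.1) (e p.2)))))).trans ?_
  simp only [Nat.cast_sum, Nat.cast_mul, Matrix.mul_apply, Finset.sum_mul,
    Fintype.sum_prod_type, cartanMatrixAlgebra_apply, multiplicityMatrix, Matrix.of_apply]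
  exact Finset.sum_congr rfl fun c _ => Finset.sum_congr rfl fun d _ => by ring

variable (K : Bimod k A) [FiniteDimensional k K]

theorem cartanMatrix_tensorObj :
    cartanMatrix e (tensorObj K Q)
      = cartanMatrixAlgebra k e * multiplicityMatrix N * cartanMatrix e K := by
  ext i j
  let F := (tensorBifunctor k A).obj K ⋙ cutFunctor k (envIdempotent k e (j, i))
  have := finiteDimensional_moduleCat (k := k) Q
  have := finiteDimensional_tensorObj (K := K) (N := Q)
  have : FiniteDimensional k (F.obj Q) := finiteDimensional_cutFunctor_obj _ (tensorObj K Q)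
  have hcut (c : Fin r) : cartanMatrix e K c j
      = linearRank (Algebra.lsmul k k K (e j ⊗ₜ[k] MulOpposite.op (e c) : Env k A)) := rfl
  refine (congrArg (Nat.cast : ℕ → ℤ) ((hN F).trans
    (Finset.sum_congr rfl fun p _ => congrArg (N p * ·)
      (linearRank_cutFunctor_tensor_map_rightMul (e j) (e i) (e p.1) (e p.2))))).trans ?_
  simp only [hcut, Nat.cast_sum, Nat.cast_mul, Matrix.mul_apply, Finset.sum_mul,
    Fintype.sum_prod_type, cartanMatrixAlgebra_apply, multiplicityMatrix, Matrix.of_apply]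
  exact Finset.sum_congr rfl fun c _ => Finset.sum_congr rfl fun d _ => by ring

theorem finrank_envTensor_tensorObj :
    (Module.finrank k ((envTensorFunctor k A).obj (tensorObj K Q)) : ℤ)
      = (multiplicityMatrix N * cartanMatrix e K).trace := by
  let F := (tensorBifunctor k A).obj K ⋙ envTensorFunctor k A
  have := finiteDimensional_moduleCat (k := k) Q
  have := finiteDimensional_tensorObj (K := K) (N := Q)
  have : FiniteDimensional k (F.obj Q) := finiteDimensional_envTensor (tensorObj K Q)
  refine (congrArg (Nat.cast : ℕ → ℤ) (hN F)).trans ?_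
  simp only [F, linearRank_envTensor_tensor_map_rightMul, envIdempotent, Nat.cast_sum,
    Nat.cast_mul, Matrix.trace, Matrix.diag, Matrix.mul_apply, multiplicityMatrix, Matrix.of_apply,
    Fintype.sum_prod_type]
  exact Finset.sum_comm

end IsMultiplicity

variable {πe : Env k A →ₐ[k] (Fin r × Fin r → k)} (h : IsSplitBasic (envIdempotent k e) πe)
  (hC : IsUnit (cartanMatrixAlgebra k e).det) (K Q : Bimod k A) [FiniteDimensional k K]
  [Module.Finite (Env k A) Q] [Module.Projective (Env k A) Q]
include h hC

theorem cartanMatrix_tensorObj_of_projective :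
    cartanMatrix e (tensorObj K Q)
      = cartanMatrix e Q * ((cartanMatrixAlgebra k e)⁻¹ * cartanMatrix e K) := by
  obtain ⟨N, hN⟩ := h.exists_isMultiplicity Q
  rw [hN.cartanMatrix_tensorObj K, hN.cartanMatrix_eq, ← Matrix.mul_assoc,
    Matrix.mul_nonsing_inv_cancel_right _ _ hC]

theorem finrank_envTensor_tensorObj_of_projective :
    (Module.finrank k ((envTensorFunctor k A).obj (tensorObj K Q)) : ℤ)
      = (cartanMatrix e Q * ((cartanMatrixAlgebra k e)⁻¹ * cartanMatrix e K)
        * (cartanMatrixAlgebra k e)⁻¹).trace := by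
  obtain ⟨N, hN⟩ := h.exists_isMultiplicity Q
  rw [hN.finrank_envTensor_tensorObj K, hN.cartanMatrix_eq, ← Matrix.mul_assoc,
    Matrix.mul_nonsing_inv_cancel_right _ _ hC,
    Matrix.trace_mul_comm _ (cartanMatrixAlgebra k e)⁻¹, Matrix.mul_assoc _ _ (cartanMatrix e K),
    Matrix.nonsing_inv_mul_cancel_left _ _ hC]

end CartanTensor

/-! ### Tensor products of complexes -/

section TensorComplex

open scoped ModuleCat Pointwise

variable {k A : Type u} [Field k] [Ring A] [Algebra k A]
  (K L : CochainComplex (Bimod k A) ℤ)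

/-- The inclusion of the summand `Kᵖ ⊗_A Lⁿ⁻ᵖ` into the `n`-th term of `K ⊗_A L`. -/
def tensorInc (n p : ℤ) : tensorObj (K.X p) (L.X (n - p)) ⟶ (tensorComplex K L).X n :=
  HomologicalComplex.ιMapBifunctor K L (tensorBifunctor k A) (ComplexShape.up ℤ) p (n - p) n
    (add_sub_cancel p n)

/-- The projection of the `n`-th term of `K ⊗_A L` onto the summand `Kᵖ ⊗_A Lⁿ⁻ᵖ`. -/
def tensorProj (n p : ℤ) : (tensorComplex K L).X n ⟶ tensorObj (K.X p) (L.X (n - p)) :=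
  HomologicalComplex.mapBifunctorDesc fun p' q' h =>
    if hp : p' = p then eqToHom (by
      have h' : p' + q' = n := h
      have hq : q' = n - p := by omega
      rw [hp, hq]) else 0

theorem tensorInc_tensorProj_self (n p : ℤ) :
    tensorInc K L n p ≫ tensorProj K L n p = 𝟙 _ := by
  refine (HomologicalComplex.ι_mapBifunctorDesc (K₁ := K) (K₂ := L) (F := tensorBifunctor k A)
    (c := ComplexShape.up ℤ) _ p (n - p) _).trans ?_
  rw [dif_pos rfl, eqToHom_refl]

theorem tensorInc_tensorProj_of_ne (n : ℤ) {p p' : ℤ} (h : p ≠ p') :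
    tensorInc K L n p ≫ tensorProj K L n p' = 0 := by
  refine (HomologicalComplex.ι_mapBifunctorDesc (K₁ := K) (K₂ := L) (F := tensorBifunctor k A)
    (c := ComplexShape.up ℤ) _ p (n - p) _).trans ?_
  rw [dif_neg h]

variable {K} {s : Finset ℤ} (hs : ∀ p ∉ s, Limits.IsZero (K.X p)) (n : ℤ)
include hs

theorem sum_tensorProj_comp_tensorInc :
    ∑ p : s, tensorProj K L n p ≫ tensorInc K L n p = 𝟙 ((tensorComplex K L).X n) := by
  refine HomologicalComplex.mapBifunctor.hom_ext fun p q h => ?_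
  have h' : p + q = n := h
  obtain rfl : q = n - p := by omega
  by_cases hp : p ∈ s
  · change tensorInc K L n p ≫ _ = tensorInc K L n p ≫ _
    rw [Preadditive.comp_sum, Finset.sum_eq_single ⟨p, hp⟩, Category.comp_id, ← Category.assoc,
      tensorInc_tensorProj_self, Category.id_comp]
    · intro p' _ hne
      rw [← Category.assoc, tensorInc_tensorProj_of_ne K L n fun h => hne (Subtype.ext h.symm),
        Limits.zero_comp]
    · simp
  · exact (((tensorBifunctor k A).flip.obj (L.X (n - p))).map_isZero (hs p hp)).eq_of_src _ _

section AdditiveFunctor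

variable (F : Bimod k A ⥤ ModuleCat.{u} k) [F.Additive]
  [∀ p, FiniteDimensional k (F.obj (tensorObj (K.X p) (L.X (n - p))))]

theorem finiteDimensional_obj_tensorComplex_X :
    FiniteDimensional k (F.obj ((tensorComplex K L).X n)) :=
  finiteDimensional_obj_of_sum_comp_eq_id F (sum_tensorProj_comp_tensorInc L hs n)

theorem finrank_obj_tensorComplex_X :
    Module.finrank k (F.obj ((tensorComplex K L).X n))
      = ∑ p ∈ s, Module.finrank k (F.obj (tensorObj (K.X p) (L.X (n - p)))) := by
  have := finiteDimensional_obj_tensorComplex_X L hs n F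
  rw [finrank_obj_eq_sum_linearRank F (sum_tensorProj_comp_tensorInc L hs n) fun p p' h =>
    tensorInc_tensorProj_of_ne K L n fun h' => h (Subtype.ext h'),
    ← Finset.sum_coe_sort s fun p => Module.finrank k (F.obj (tensorObj (K.X p) (L.X (n - p))))]
  refine Finset.sum_congr rfl fun p _ => ?_
  rw [tensorInc_tensorProj_self, F.map_id, ModuleCat.hom_id, linearRank_id]

end AdditiveFunctor

variable {L} {n}

theorem isZero_tensorComplex_X {t : Finset ℤ} (ht : ∀ q ∉ t, Limits.IsZero (L.X q))
    (hn : n ∉ s + t) : Limits.IsZero ((tensorComplex K L).X n) := by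
  rw [Limits.IsZero.iff_id_eq_zero, ← sum_tensorProj_comp_tensorInc L hs n]
  refine Finset.sum_eq_zero fun p _ => ?_
  have hL : Limits.IsZero (L.X (n - p)) := ht _ fun hnp =>
    hn (Finset.mem_add.2 ⟨p, p.2, n - p, hnp, add_sub_cancel _ n⟩)
  rw [(((tensorBifunctor k A).obj (K.X p)).map_isZero hL).eq_of_src (tensorInc K L n p) 0,
    Limits.comp_zero]

end TensorComplex

section Bounded

open scoped Pointwise

theorem IsBoundedComplex.exists_finset {𝒞 : Type*} [Category 𝒞] [Limits.HasZeroMorphisms 𝒞]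
    {K : CochainComplex 𝒞 ℤ} (hK : IsBoundedComplex K) :
    ∃ s : Finset ℤ, ∀ p ∉ s, Limits.IsZero (K.X p) :=
  ⟨Set.Finite.toFinset hK, fun _ hp => by_contra fun h => hp ((Set.Finite.mem_toFinset hK).2 h)⟩

variable {k A : Type u} [Field k] [Ring A] [Algebra k A] {K L : CochainComplex (Bimod k A) ℤ}

theorem IsBoundedComplex.tensorComplex (hK : IsBoundedComplex K) (hL : IsBoundedComplex L) :
    IsBoundedComplex (tensorComplex K L) := by
  obtain ⟨s, hs⟩ := hK.exists_finset
  obtain ⟨t, ht⟩ := hL.exists_finset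
  exact (s + t).finite_toSet.subset fun n hn =>
    by_contra fun h => hn (isZero_tensorComplex_X hs ht h)

end Bounded

/-! ### Euler matrices -/

section EulerMatrix

open scoped ModuleCat

variable {k A : Type u} [Field k] [Ring A] [Algebra k A] {r : ℕ} {e : Fin r → A}

/-- The Euler matrix of a bounded complex of bimodules: the alternating sum of the Cartan matrices
of its terms. -/
def eulerMatrix (e : Fin r → A) (K : CochainComplex (Bimod k A) ℤ) : Matrix (Fin r) (Fin r) ℤ :=
  altSum fun l => cartanMatrix e (K.X l)

theorem cartanMatrix_eq_zero (e : Fin r → A) {X : Bimod k A} (h : Limits.IsZero X) :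
    cartanMatrix e X = 0 := by
  ext i j
  rw [cartanMatrix_apply, finrank_eq_zero_of_isZero ((cutFunctor k _).map_isZero h)]
  rfl

theorem cartanMatrix_congr {X Y : Bimod k A} (φ : X ≅ Y) :
    cartanMatrix e X = cartanMatrix e Y := by
  ext i j
  rw [cartanMatrix_apply, cartanMatrix_apply,
    ((cutFunctor k (envIdempotent k e (j, i))).mapIso φ).toLinearEquiv.finrank_eq]

theorem cartanMatrixComplex_congr {K L : CochainComplex (Bimod k A) ℤ} (f : K ⟶ L) [QuasiIso f] :
    cartanMatrixComplex e K = cartanMatrixComplex e L :=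
  finsum_congr fun l => by rw [cartanMatrix_congr (isoOfQuasiIsoAt f l)]

theorem support_cartanMatrix_subset {K : CochainComplex (Bimod k A) ℤ} {s : Finset ℤ}
    (hs : ∀ p ∉ s, Limits.IsZero (K.X p)) (e : Fin r → A) :
    (fun p => cartanMatrix e (K.X p)).support ⊆ s :=
  fun _ hp => by_contra fun hps => hp (cartanMatrix_eq_zero e (hs _ hps))

theorem IsBoundedComplex.finite_support_cartanMatrix {K : CochainComplex (Bimod k A) ℤ}
    (hK : IsBoundedComplex K) (e : Fin r → A) :
    (fun l => cartanMatrix e (K.X l)).support.Finite :=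
  hK.finite_support fun _ => cartanMatrix_eq_zero e

theorem cartanMatrixComplex_eq_eulerMatrix (he : ∀ p, IsIdempotentElem (envIdempotent k e p))
    {P : CochainComplex (Bimod k A) ℤ} (hP : IsBoundedComplex P)
    [∀ i, FiniteDimensional k (P.X i)] : cartanMatrixComplex e P = eulerMatrix e P := by
  ext i j
  let F := cutFunctor k (envIdempotent k e (j, i))
  have : F.PreservesHomology := cutFunctor_preservesHomology (he (j, i))
  have : ∀ l, FiniteDimensional k
      (((F.mapHomologicalComplex (ComplexShape.up ℤ)).obj P).X l) :=
    fun l => finiteDimensional_cutFunctor_obj _ (P.X l)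
  have hhom (l : ℤ) : cartanMatrix e (P.homology l) i j = Module.finrank k
      (((F.mapHomologicalComplex (ComplexShape.up ℤ)).obj P).homology l) :=
    congrArg Nat.cast ((P.sc l).mapHomologyIso F).toLinearEquiv.finrank_eq.symm
  have hsupp : (fun l => cartanMatrix e (P.homology l)).support.Finite := hP.finite_support
    fun l hl => cartanMatrix_eq_zero e (ShortComplex.isZero_homology_of_isZero_X₂ _ hl)
  have := altSum_finrank_homology (hP.map F)
  calc cartanMatrixComplex e P i j
    _ = altSum fun l => cartanMatrix e (P.homology l) i j :=
        map_altSum (Matrix.entryAddMonoidHom ℤ i j) hsupp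
    _ = altSum fun l => cartanMatrix e (P.X l) i j := by simp only [hhom, this]; rfl
    _ = eulerMatrix e P i j :=
        (map_altSum (Matrix.entryAddMonoidHom ℤ i j) (hP.finite_support_cartanMatrix e)).symm

end EulerMatrix

section TensorEuler

open scoped ModuleCat

variable {k A : Type u} [Field k] [Ring A] [Algebra k A] [FiniteDimensional k A] {r : ℕ}
  {e : Fin r → A} {πe : Env k A →ₐ[k] (Fin r × Fin r → k)} {K P : CochainComplex (Bimod k A) ℤ}

variable [∀ i, FiniteDimensional k (K.X i)] [∀ i, Module.Finite (Env k A) (P.X i)]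

theorem finiteDimensional_tensorObj_X (p q : ℤ) :
    FiniteDimensional k (tensorObj (K.X p) (P.X q)) :=
  have := finiteDimensional_moduleCat (k := k) (P.X q)
  finiteDimensional_tensorObj

theorem finiteDimensional_tensorComplex_X (hK : IsBoundedComplex K) (n : ℤ) :
    FiniteDimensional k ((tensorComplex K P).X n) := by
  obtain ⟨s, hs⟩ := hK.exists_finset
  let F := ModuleCat.restrictScalars (algebraMap k (Env k A))
  have (p : ℤ) : FiniteDimensional k (F.obj (tensorObj (K.X p) (P.X (n - p)))) :=
    finiteDimensional_tensorObj_X p (n - p)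
  exact finiteDimensional_obj_tensorComplex_X P hs n F

theorem finiteDimensional_envTensorComplex_tensorComplex_X (hK : IsBoundedComplex K) (n : ℤ) :
    FiniteDimensional k ((envTensorComplex (tensorComplex K P)).X n) :=
  have := finiteDimensional_tensorComplex_X (P := P) hK n
  finiteDimensional_envTensor ((tensorComplex K P).X n)

variable (h : IsSplitBasic (envIdempotent k e) πe) (hC : IsUnit (cartanMatrixAlgebra k e).det)
  (hK : IsBoundedComplex K) (hP : IsBoundedComplex P)
  [∀ i, Module.Projective (Env k A) (P.X i)]

include h hC hK hP

theorem eulerMatrix_tensorComplex :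
    eulerMatrix e (tensorComplex K P)
      = eulerMatrix e P * ((cartanMatrixAlgebra k e)⁻¹ * eulerMatrix e K) := by
  obtain ⟨s, hs⟩ := hK.exists_finset
  let φ : Matrix (Fin r) (Fin r) ℤ →+ Matrix (Fin r) (Fin r) ℤ →+ Matrix (Fin r) (Fin r) ℤ :=
    AddMonoidHom.mul.flip.comp (AddMonoidHom.mulLeft (cartanMatrixAlgebra k e)⁻¹)
  have hterm (n : ℤ) : cartanMatrix e ((tensorComplex K P).X n)
      = ∑ p ∈ s, φ (cartanMatrix e (K.X p)) (cartanMatrix e (P.X (n - p))) := by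
    ext i j
    let F := cutFunctor k (envIdempotent k e (j, i))
    have (p : ℤ) : FiniteDimensional k (F.obj (tensorObj (K.X p) (P.X (n - p)))) :=
      have := finiteDimensional_tensorObj_X (K := K) (P := P) p (n - p)
      finiteDimensional_cutFunctor_obj _ _
    rw [cartanMatrix_apply, finrank_obj_tensorComplex_X P hs n F, Nat.cast_sum, Matrix.sum_apply]
    refine Finset.sum_congr rfl fun p _ => ?_
    exact congrFun (congrFun (cartanMatrix_tensorObj_of_projective h hC _ _) i) j
  rw [eulerMatrix, funext hterm, altSum_convolution φ (support_cartanMatrix_subset hs e)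
    (hP.finite_support_cartanMatrix e)]
  rfl

theorem altSum_finrank_envTensorComplex_tensorComplex :
    (altSum fun i => (Module.finrank k ((envTensorComplex (tensorComplex K P)).X i) : ℤ))
      = (eulerMatrix e P * ((cartanMatrixAlgebra k e)⁻¹ * eulerMatrix e K)
          * (cartanMatrixAlgebra k e)⁻¹).trace := by
  obtain ⟨s, hs⟩ := hK.exists_finset
  let φ : Matrix (Fin r) (Fin r) ℤ →+ Matrix (Fin r) (Fin r) ℤ →+ ℤ :=
    (AddMonoidHom.compHom ((Matrix.traceAddMonoidHom (Fin r) ℤ).comp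
      (AddMonoidHom.mulRight (cartanMatrixAlgebra k e)⁻¹))).comp
      (AddMonoidHom.mul.flip.comp (AddMonoidHom.mulLeft (cartanMatrixAlgebra k e)⁻¹))
  have hterm (n : ℤ) : (Module.finrank k ((envTensorComplex (tensorComplex K P)).X n) : ℤ)
      = ∑ p ∈ s, φ (cartanMatrix e (K.X p)) (cartanMatrix e (P.X (n - p))) := by
    have (p : ℤ) : FiniteDimensional k
        ((envTensorFunctor k A).obj (tensorObj (K.X p) (P.X (n - p)))) :=
      have := finiteDimensional_tensorObj_X (K := K) (P := P) p (n - p)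
      finiteDimensional_envTensor _
    refine (congrArg Nat.cast (finrank_obj_tensorComplex_X P hs n (envTensorFunctor k A))).trans ?_
    rw [Nat.cast_sum]
    exact Finset.sum_congr rfl fun p _ => finrank_envTensor_tensorObj_of_projective h hC _ _
  rw [funext hterm, altSum_convolution φ (support_cartanMatrix_subset hs e)
    (hP.finite_support_cartanMatrix e)]
  rfl

end TensorEuler

/-! ### Growth of the traces of powers -/

section Growth

open Filter Module Module.End

variable {K V : Type*} [Field K] [AddCommGroup V] [Module K V] [FiniteDimensional K V]
  (f : End K V)

theorem trace_pow_of_isNilpotent_sub {f : End K V} {c : K}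
    (hf : IsNilpotent (f - algebraMap K (End K V) c)) (n : ℕ) :
    LinearMap.trace K V (f ^ n) = finrank K V * c ^ n := by
  have hc : Commute f (algebraMap K (End K V) c) := (Algebra.commutes c f).symm
  have hnil : IsNilpotent (f ^ n - algebraMap K (End K V) (c ^ n)) := by
    rw [map_pow, ← hc.geom_sum₂_mul]
    refine Commute.isNilpotent_mul_left (Commute.sum_left _ _ _ fun i _ => ?_) hf
    exact (((Commute.refl f).sub_right hc).pow_left i).mul_left
      ((hc.symm.sub_right (Commute.refl _)).pow_left _)
  have htrace := (LinearMap.isNilpotent_trace_of_isNilpotent hnil).eq_zero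
  rw [map_sub, sub_eq_zero] at htrace
  rw [htrace, Algebra.algebraMap_eq_smul_one, map_smul, smul_eq_mul, LinearMap.trace_one, mul_comm]

open scoped Classical in
theorem isInternal_maxGenEigenspace [IsAlgClosed K] :
    DirectSum.IsInternal fun μ : f.Eigenvalues => f.maxGenEigenspace (μ : K) := by
  rw [DirectSum.isInternal_submodule_iff_iSupIndep_and_iSup_eq_top]
  refine ⟨f.independent_maxGenEigenspace.comp Subtype.val_injective, ?_⟩
  rw [eq_top_iff, ← f.iSup_maxGenEigenspace_eq_top]
  refine iSup_le fun μ => ?_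
  by_cases hμ : f.HasEigenvalue μ
  · exact le_iSup (fun μ : f.Eigenvalues => f.maxGenEigenspace (μ : K)) ⟨μ, hμ⟩
  · have : f.maxGenEigenspace μ = ⊥ :=
      not_not.1 fun h => hμ (HasUnifEigenvalue.lt zero_lt_one h)
    rw [this]
    exact bot_le

theorem trace_pow_eq_sum_eigenvalues [IsAlgClosed K] (n : ℕ) :
    LinearMap.trace K V (f ^ n)
      = ∑ μ : f.Eigenvalues, (finrank K (f.maxGenEigenspace μ) : K) * (μ : K) ^ n := by
  classical
  have hmaps (μ : K) := mapsTo_maxGenEigenspace_of_comm (Commute.refl f) μ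
  have hmaps' (μ : K) := mapsTo_maxGenEigenspace_of_comm ((Commute.refl f).pow_right n) μ
  rw [LinearMap.trace_eq_sum_trace_restrict (isInternal_maxGenEigenspace f) fun μ => hmaps' μ]
  refine Finset.sum_congr rfl fun μ _ => ?_
  rw [← Module.End.pow_restrict n (hmaps μ) (hmaps' μ)]
  exact trace_pow_of_isNilpotent_sub (f.isNilpotent_restrict_maxGenEigenspace_sub_algebraMap μ) n

variable {f} in
theorem finrank_maxGenEigenspace_pos {μ : K} (hμ : f.HasEigenvalue μ) :
    0 < finrank K (f.maxGenEigenspace μ) :=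
  have hle : f.eigenspace μ ≤ f.maxGenEigenspace μ := (f.genEigenspace μ).monotone le_top
  (Submodule.one_le_finrank_iff.2 hμ).trans (Submodule.finrank_mono hle)

/- A sequence in a compact torus returns close to itself, and `v ^ n` is close to `1` when
`v ^ (m + n)` is close to `v ^ m`. -/
theorem exists_half_le_re_pow {ι : Type*} [Finite ι] {v : ι → ℂ} (hv : ∀ i, ‖v i‖ = 1) (N : ℕ) :
    ∃ n ≥ N, ∀ i, 1 / 2 ≤ (v i ^ n).re := by
  have := Fintype.ofFinite ι
  have hmem (n : ℕ) : v ^ n ∈ Metric.closedBall 0 1 := by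
    rw [mem_closedBall_zero_iff, pi_norm_le_iff_of_nonneg zero_le_one]
    exact fun i => by rw [Pi.pow_apply, norm_pow, hv i, one_pow]
  obtain ⟨a, -, φ, hφ, ha⟩ := (isCompact_closedBall (0 : ι → ℂ) 1).tendsto_subseq hmem
  obtain ⟨m, hm⟩ := Metric.cauchySeq_iff'.1 ha.cauchySeq (1 / 2) one_half_pos
  have hmono : φ m ≤ φ (m + N) := hφ.monotone (Nat.le_add_right m N)
  refine ⟨φ (m + N) - φ m, ?_, fun i => ?_⟩
  · have := hφ.add_le_nat N m
    rw [add_comm m N]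
    lia
  have hdist : ‖v i ^ (φ (m + N) - φ m) - 1‖ < 1 / 2 := by
    calc ‖v i ^ (φ (m + N) - φ m) - 1‖
      _ = ‖v i ^ φ m * (v i ^ (φ (m + N) - φ m) - 1)‖ := by
          rw [norm_mul, norm_pow, hv i, one_pow, one_mul]
      _ = dist (v i ^ φ (m + N)) (v i ^ φ m) := by
          rw [dist_eq_norm, mul_sub, ← pow_add, mul_one, Nat.add_sub_cancel' hmono]
      _ < 1 / 2 := (dist_le_pi_dist (v ^ φ (m + N)) (v ^ φ m) i).trans_lt
          (hm (m + N) (Nat.le_add_right m N))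
  have hre := (Complex.abs_re_le_norm _).trans hdist.le
  rw [Complex.sub_re, Complex.one_re, abs_le] at hre
  linarith [hre.1]

theorem exists_norm_pow_div_two_le_re_pow {ι : Type*} [Finite ι] (v : ι → ℂ) (N : ℕ) :
    ∃ n ≥ N, ∀ i, ‖v i‖ ^ n / 2 ≤ (v i ^ n).re := by
  obtain ⟨n, hn, hre⟩ := exists_half_le_re_pow
    (fun i => Complex.norm_exp_ofReal_mul_I (v i).arg) N
  refine ⟨n, hn, fun i => ?_⟩
  calc ‖v i‖ ^ n / 2
    _ = ‖v i‖ ^ n * (1 / 2) := by ring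
    _ ≤ ‖v i‖ ^ n * (Complex.exp ((v i).arg * Complex.I) ^ n).re := by gcongr; exact hre i
    _ = (v i ^ n).re := by
      rw [← Complex.re_ofReal_mul, Complex.ofReal_pow, ← mul_pow, Complex.norm_mul_exp_arg_mul_I]

theorem frequently_norm_pow_div_two_le_norm_trace {V : Type*} [AddCommGroup V] [Module ℂ V]
    [FiniteDimensional ℂ V] {f : End ℂ V} {μ : ℂ} (hμ : f.HasEigenvalue μ) :
    ∃ᶠ n in atTop, ‖μ‖ ^ n / 2 ≤ ‖LinearMap.trace ℂ V (f ^ n)‖ := by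
  refine frequently_atTop.2 fun N => ?_
  obtain ⟨n, hn, hre⟩ := exists_norm_pow_div_two_le_re_pow (fun ν : f.Eigenvalues => (ν : ℂ)) N
  have hnonneg (ν : f.Eigenvalues) : 0 ≤ ((ν : ℂ) ^ n).re := le_trans (by positivity) (hre ν)
  let d (ν : f.Eigenvalues) : ℕ := finrank ℂ (f.maxGenEigenspace ν)
  refine ⟨n, hn, ?_⟩
  calc ‖μ‖ ^ n / 2
    _ ≤ (μ ^ n).re := hre ⟨μ, hμ⟩
    _ ≤ d ⟨μ, hμ⟩ * (μ ^ n).re := le_mul_of_one_le_left (hnonneg ⟨μ, hμ⟩)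
        (Nat.one_le_cast.2 (finrank_maxGenEigenspace_pos hμ))
    _ ≤ ∑ ν, d ν * ((ν : ℂ) ^ n).re := Finset.single_le_sum
        (f := fun ν : f.Eigenvalues => d ν * ((ν : ℂ) ^ n).re)
        (fun ν _ => mul_nonneg (Nat.cast_nonneg _) (hnonneg ν)) (Finset.mem_univ _)
    _ = (LinearMap.trace ℂ V (f ^ n)).re := by
        simp only [trace_pow_eq_sum_eigenvalues, Complex.re_sum, ← Complex.ofReal_natCast,
          Complex.re_ofReal_mul, d]
    _ ≤ ‖LinearMap.trace ℂ V (f ^ n)‖ := Complex.re_le_norm _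

theorem log_le_expGrowthSup_of_frequently_le {b x : ENNReal} {t : ℕ → ENNReal} (hb : b ≠ 0)
    (ht : ∃ᶠ n in atTop, b * x ^ n ≤ t n) : ENNReal.log x ≤ ExpGrowth.expGrowthSup t :=
  calc ENNReal.log x
    _ = ExpGrowth.expGrowthInf fun n => x ^ n := ExpGrowth.expGrowthInf_pow.symm
    _ ≤ ExpGrowth.expGrowthInf fun n => b * x ^ n :=
        ExpGrowth.expGrowthInf_of_eventually_ge hb (Eventually.of_forall fun _ => le_rfl)
    _ ≤ ExpGrowth.expGrowthSup t := ExpGrowth.expGrowthInf_le_expGrowthSup_of_frequently_le ht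

theorem log_matrixSpectralRadius_le_expGrowthSup {r : ℕ} (B : Matrix (Fin r) (Fin r) ℤ)
    {t : ℕ → ENNReal} (ht : ∀ᶠ n in atTop, ((B ^ n).trace.natAbs : ENNReal) ≤ t n) :
    ENNReal.log (matrixSpectralRadius B) ≤ ExpGrowth.expGrowthSup t := by
  let f := Matrix.toLin' (B.map (Int.cast : ℤ → ℂ))
  have htrace (n : ℕ) : ‖LinearMap.trace ℂ _ (f ^ n)‖ = ((B ^ n).trace.natAbs : ℝ) := by
    have hmap : B.map (Int.cast : ℤ → ℂ) ^ n = (B ^ n).map (Int.castAddHom ℂ) :=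
      (Matrix.map_pow B (Int.castRingHom ℂ) n).symm
    rw [← Matrix.toLin'_pow, Matrix.trace_toLin'_eq, hmap, ← AddMonoidHom.map_trace,
      Int.coe_castAddHom, Complex.norm_intCast, Nat.cast_natAbs, Int.cast_abs]
  rw [← ENNReal.logOrderIso_apply, ← OrderIso.le_symm_apply]
  refine iSup₂_le fun μ hμ => ?_
  rw [OrderIso.le_symm_apply, ENNReal.logOrderIso_apply]
  rw [← Matrix.spectrum_toLin', ← hasEigenvalue_iff_mem_spectrum] at hμ
  refine log_le_expGrowthSup_of_frequently_le (b := 2⁻¹) (by simp)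
    (((frequently_norm_pow_div_two_le_norm_trace hμ).and_eventually ht).mono fun n hn => ?_)
  have hle : ‖μ‖ ^ n ≤ 2 * (B ^ n).trace.natAbs := by linarith [hn.1.trans_eq (htrace n)]
  refine le_trans ?_ hn.2
  rw [ENNReal.inv_mul_le_iff two_ne_zero ENNReal.ofNat_ne_top]
  exact_mod_cast hle

end Growth

/-! ### The entropy of a perfect complex -/

section Entropy

open scoped ModuleCat

theorem natAbs_trace_neg_pow {r : ℕ} (B : Matrix (Fin r) (Fin r) ℤ) (n : ℕ) :
    ((-B) ^ n).trace.natAbs = (B ^ n).trace.natAbs := by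
  obtain hn | hn := Nat.even_or_odd n
  · rw [hn.neg_pow]
  · rw [hn.neg_pow, Matrix.trace_neg, Int.natAbs_neg]

variable {k A : Type u} [Field k] [Ring A] [Algebra k A]

theorem PerfectResolution.hhEntropy_eq_expGrowthSup {M : CochainComplex (Bimod k A) ℤ}
    (R : PerfectResolution M) : R.hhEntropy =
      ExpGrowth.expGrowthSup fun n => tdim (envTensorComplex (tensorPowSucc R.P (n - 1))) :=
  Filter.limsup_nat_add (fun n : ℕ =>
    ENNReal.log (tdim (envTensorComplex (tensorPowSucc R.P (n - 1)))) / (n : EReal)) 1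

variable {P : CochainComplex (Bimod k A) ℤ} (hP : IsBoundedComplex P)

include hP in
theorem IsBoundedComplex.tensorPowSucc (n : ℕ) : IsBoundedComplex (tensorPowSucc P n) := by
  induction n with
  | zero => exact hP
  | succ n ih => exact ih.tensorComplex hP

variable [FiniteDimensional k A] [∀ i, Module.Finite (Env k A) (P.X i)]

include hP in
theorem finiteDimensional_tensorPowSucc_X (n : ℕ) (i : ℤ) :
    FiniteDimensional k ((tensorPowSucc P n).X i) := by
  induction n generalizing i with
  | zero => exact finiteDimensional_moduleCat (P.X i)
  | succ n ih => exact finiteDimensional_tensorComplex_X (hP.tensorPowSucc n) i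

variable {r : ℕ} {e : Fin r → A} {πe : Env k A →ₐ[k] (Fin r × Fin r → k)}
  (h : IsSplitBasic (envIdempotent k e) πe) (hC : IsUnit (cartanMatrixAlgebra k e).det)
  [∀ i, Module.Projective (Env k A) (P.X i)]

include hP h hC

theorem eulerMatrix_tensorPowSucc (n : ℕ) : eulerMatrix e (tensorPowSucc P n)
    = (eulerMatrix e P * (cartanMatrixAlgebra k e)⁻¹) ^ n * eulerMatrix e P := by
  induction n with
  | zero => rw [pow_zero, one_mul]; rfl
  | succ n ih =>
    have := finiteDimensional_tensorPowSucc_X hP n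
    refine (eulerMatrix_tensorComplex h hC (hP.tensorPowSucc n) hP).trans ?_
    rw [ih, pow_succ']
    simp only [Matrix.mul_assoc]

theorem natAbs_trace_pow_le_tdim (n : ℕ) :
    (((eulerMatrix e P * (cartanMatrixAlgebra k e)⁻¹) ^ (n + 2)).trace.natAbs : ENNReal)
      ≤ tdim (envTensorComplex (tensorPowSucc P (n + 1))) := by
  have hn := hP.tensorPowSucc n
  have := finiteDimensional_tensorPowSucc_X hP n
  have := finiteDimensional_envTensorComplex_tensorComplex_X (P := P) hn
  have heuler := altSum_finrank_envTensorComplex_tensorComplex h hC hn hP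
  have hpow : (eulerMatrix e P * (cartanMatrixAlgebra k e)⁻¹) ^ (n + 2)
      = eulerMatrix e P * ((cartanMatrixAlgebra k e)⁻¹ * eulerMatrix e (tensorPowSucc P n))
        * (cartanMatrixAlgebra k e)⁻¹ := by
    rw [eulerMatrix_tensorPowSucc hP h hC, pow_succ, pow_succ']
    simp only [Matrix.mul_assoc]
  rw [hpow, ← heuler]
  exact natAbs_altSum_finrank_le_tdim ((hn.tensorComplex hP).map (envTensorFunctor k A))

end Entropy

end HHEntropy

end

theorem theorem5 (k A : Type u) [Field k] [Ring A] [Algebra k A] [FiniteDimensional k A]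
    (helem : HHEntropy.IsElementary k A) (hgl : HHEntropy.FiniteGlobalDimension A)
    {r : ℕ} (e : Fin r → A) (hcomplete : CompleteOrthogonalIdempotents e)
    (hprim : ∀ i, HHEntropy.IsPrimitiveIdempotent (e i))
    (M : CochainComplex (HHEntropy.Bimod k A) ℤ) (R : HHEntropy.PerfectResolution M) :
    IsUnit (HHEntropy.cartanMatrixAlgebra k e).det ∧
      ENNReal.log (HHEntropy.matrixSpectralRadius (HHEntropy.dualCoxeterMatrix e M))
        ≤ R.hhEntropy := by
  obtain ⟨π, hπ⟩ := helem.exists_isSplitBasic hcomplete hprim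
  obtain ⟨πe, hπe⟩ := hπ.exists_isSplitBasic_env
  have hC := hπ.isUnit_det_cartanMatrixAlgebra hgl
  have := R.finite
  have := R.projective
  have := R.quasiIso
  have (i : ℤ) := HHEntropy.finiteDimensional_moduleCat (k := k) (R.P.X i)
  have hCM : HHEntropy.cartanMatrixComplex e M = HHEntropy.eulerMatrix e R.P :=
    (HHEntropy.cartanMatrixComplex_congr R.π).symm.trans
      (HHEntropy.cartanMatrixComplex_eq_eulerMatrix hπe.complete.idem R.bounded)
  refine ⟨hC, R.hhEntropy_eq_expGrowthSup ▸
    HHEntropy.log_matrixSpectralRadius_le_expGrowthSup _ ?_⟩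
  filter_upwards [Filter.eventually_ge_atTop 2] with n hn
  obtain ⟨m, rfl⟩ := Nat.exists_eq_add_of_le' hn
  rw [HHEntropy.dualCoxeterMatrix, HHEntropy.natAbs_trace_neg_pow, hCM]
  exact HHEntropy.natAbs_trace_pow_le_tdim R.bounded hπe hC m
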